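/- Let $\mathbb H=\mathbb R$ or $\mathbb H=\mathbb C$, and write $t_-=\max(-t,0)$. For a random vector $a$ in $\mathbb H^d$ put $\|a\|_{\psi_2}=\sup_{\|v\|=1}\sup_{p\ge 1}p^{-1/2}(\mathbb E|a^*v|^p)^{1/p}$; $a$ is sub-gaussian if this is finite. For a matrix $A$ let $\mathbf D(A)$ be its diagonal part. Consider random vectors $a_1,\dots,a_N$ in $\mathbb H^d$, put $A_j=a_ja_j^*$, and consider the following conditions. (I) $a_1,\dots,a_N$ are i.i.d. sub-gaussian; with probability one, for each $j$, the matrix $A_j-\mathbf D(A_j)$ is not purely imaginary (its real part is not $0$) and $\mathbf D(A_j)$ is not a scalar multiple of $I$. (II) $\mathbb E(a_j)=0$, $\mathbb E(A_j)=\tau_1 I$, and $\mathbb E\big((x^*A_jx)A_j\big)=\tau_2\|x\|^2I+\tau_3xx^*+\tau_4\,\mathrm{diag}(|x_1|^2,\dots,|x_d|^2)$ for all $x\in\mathbb H^d$, with real constants $\tau_1,\dots,\tau_4$ independent of $x$. Set $\alpha=\tau_2+\tau_3-(\tau_4)_-$, $\beta=\tau_3-(\tau_4)_-$, $\hat\alpha=\tau_2+\tau_3+|\tau_4|$,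 $$\varepsilon_0=\frac{10}{27\alpha}\Big(\sqrt{36|\tau_4|^2+\tfrac{27\alpha\beta}{10}}-6|\tau_4|\Big),$$ $$R=\max\Big(96\,\frac{\hat\alpha^2(1+\delta^2)}{\beta-\delta},\ 270\,\hat\alpha(1+\delta)+60\,d\,(\log N)\,\tau_1(1+\delta)\,\varepsilon_0^2\Big).$$ For $x,z\in\mathbb H^d$ let $\mathrm{dist}(z,x)=\min\{\|z-ux\|:u\in\mathbb H,\ |u|=1\}$ and $S(x,\varepsilon)=\{z\in\mathbb H^d:\mathrm{dist}(z,x)\le\varepsilon\|x\|\}$. With $y_j=x^*A_jx$, the Wirtinger Flow iterates with step size $\xi$ started at $z_0\in\mathbb H^d$ are $$z_{k+1}=z_k-\xi\cdot\frac1N\sum_{j=1}^N(z_k^*A_jz_k-y_j)A_jz_k .$$ **Proposition.** For every $K\ge 0$ there is a constant $c>0$ depending only on $K$, and for every $\delta>0$ there are constants $c_\delta,C_\delta>0$ depending only on $K$ and $\delta$, such that the following holds for all $d$ and $N$. Let $a_1,\dots,a_N$ satisfy (I) and (II) with $\|a_j\|_{\psi_2}\le K$, let $\delta<\beta$ and $N\ge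 C_\delta\,d\log^2d$, and let $x\in\mathbb H^d$ be a fixed vector with $\|x\|=1$. Then with probability greater than $$1-\frac1{d^3}-\exp(-cd)-2\exp(-c_\delta N)$$ one has, simultaneously for all $z_0\in S(x,\varepsilon_0)$, all step sizes $0<\xi\le 2/R$ and all $k\ge 0$, $$\mathrm{dist}^2(z_{k+1},x)\le\Big(1-\frac{\xi(\beta-\delta)}4\Big)\,\mathrm{dist}^2(z_k,x).$$ -/

import Mathlib

open MeasureTheory ProbabilityTheory
open scoped ENNReal NNReal Matrix

namespace PhaseRetrieval

noncomputable section

/-- The signal space `𝕜^d` with its Euclidean norm; `𝕜` is `ℝ` or `ℂ`. -/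
abbrev Signal (𝕜 : Type*) (d : ℕ) : Type _ := EuclideanSpace 𝕜 (Fin d)

/-- The rank one Hermitian matrix `a a*`, with entries `a_m * conj a_n`. -/
def outer {𝕜 : Type*} [RCLike 𝕜] {d : ℕ} (a : Signal 𝕜 d) : Matrix (Fin d) (Fin d) 𝕜 :=
  Matrix.of fun m n => a m * star (a n)

/-- The value `z* A z` of a matrix `A` at a vector `z`. -/
def quad {𝕜 : Type*} [RCLike 𝕜] {d : ℕ} (A : Matrix (Fin d) (Fin d) 𝕜) (z : Signal 𝕜 d) : 𝕜 :=
  star z.ofLp ⬝ᵥ (A *ᵥ z.ofLp)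

/-- The expectation of a random matrix, entry by entry. -/
def expMatrix {𝕜 Ω : Type*} [RCLike 𝕜] [MeasurableSpace Ω] {d : ℕ} (μ : Measure Ω)
    (M : Ω → Matrix (Fin d) (Fin d) 𝕜) : Matrix (Fin d) (Fin d) 𝕜 :=
  Matrix.of fun m n => ∫ ω, M ω m n ∂μ

/-- The sub-gaussian (`ψ₂`) norm of a random vector: the least `K` such that
`(𝔼 |a* v|^p)^(1/p) ≤ K * √p` for all unit vectors `v` and all real `p ≥ 1`. -/
def psiTwoNorm {𝕜 Ω : Type*} [RCLike 𝕜] [MeasurableSpace Ω] {d : ℕ} (μ : Measure Ω)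
    (a : Ω → Signal 𝕜 d) : ℝ≥0∞ :=
  ⨆ (v : Signal 𝕜 d) (_ : ‖v‖ = 1) (p : ℝ) (_ : 1 ≤ p),
    eLpNorm (fun ω => inner 𝕜 (a ω) v) (ENNReal.ofReal p) μ / ENNReal.ofReal (Real.sqrt p)

/-- Condition (I): the `a j` are i.i.d. sub-gaussian random vectors, and with probability one
`A_j - D(A_j)` is not purely imaginary (its real part does not vanish) and `D(A_j)` is not a
multiple of the identity, where `A_j = a_j a_j*` and `D(A_j)` is the diagonal part of `A_j`. -/
structure ConditionI {𝕜 Ω : Type*} [RCLike 𝕜] [MeasurableSpace Ω] {d N : ℕ} (μ : Measure Ω)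
    (a : Fin N → Ω → Signal 𝕜 d) : Prop where
  indep : iIndepFun a μ
  identDistrib : ∀ i j, IdentDistrib (a i) (a j) μ μ
  subgaussian : ∀ j, psiTwoNorm μ (a j) < ∞
  not_imaginary : ∀ j, ∀ᵐ ω ∂μ,
    ¬ ∀ m n, RCLike.re
      ((outer (a j ω) - Matrix.diagonal (outer (a j ω)).diag : Matrix (Fin d) (Fin d) 𝕜) m n) = 0
  not_scalar : ∀ j, ∀ᵐ ω ∂μ,
    ¬ ∃ t : 𝕜, Matrix.diagonal (outer (a j ω)).diag = t • (1 : Matrix (Fin d) (Fin d) 𝕜)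

/-- Condition (II): `𝔼 a_j = 0`, `𝔼 A_j = τ₁ I`, and for all `x`
`𝔼 ((x* A_j x) A_j) = τ₂ ‖x‖² I + τ₃ x x* + τ₄ diag(|x_1|², …, |x_d|²)`. -/
structure ConditionII {𝕜 Ω : Type*} [RCLike 𝕜] [MeasurableSpace Ω] {d N : ℕ} (μ : Measure Ω)
    (a : Fin N → Ω → Signal 𝕜 d) (τ₁ τ₂ τ₃ τ₄ : ℝ) : Prop where
  mean_zero : ∀ j, ∫ ω, a j ω ∂μ = 0
  second_moment : ∀ j, expMatrix μ (fun ω => outer (a j ω)) = (τ₁ : 𝕜) • 1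
  fourth_moment : ∀ j, ∀ x : Signal 𝕜 d,
    expMatrix μ (fun ω => quad (outer (a j ω)) x • outer (a j ω)) =
      ((τ₂ * ‖x‖ ^ 2 : ℝ) : 𝕜) • 1 + (τ₃ : 𝕜) • outer x
        + (τ₄ : 𝕜) • Matrix.diagonal fun i => ((‖x i‖ ^ 2 : ℝ) : 𝕜)

/-- The distance of `z` to the orbit of `x` under unimodular scalars:
the minimum of `‖z - e^{iθ} x‖` over `θ` if `𝕜 = ℂ`, and of `‖z ∓ x‖` if `𝕜 = ℝ`. -/
def phaseDist {𝕜 : Type*} [RCLike 𝕜] {d : ℕ} (z x : Signal 𝕜 d) : ℝ :=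
  ⨅ u : Metric.sphere (0 : 𝕜) 1, ‖z - (u : 𝕜) • x‖

/-- The neighbourhood `S(x, ε)`. -/
def nbhd {𝕜 : Type*} [RCLike 𝕜] {d : ℕ} (x : Signal 𝕜 d) (ε : ℝ) : Set (Signal 𝕜 d) :=
  {z | phaseDist z x ≤ ε * ‖x‖}

/-- The Wirtinger gradient at `z` of `(1 / 2N) ∑ j, (z* A_j z - y_j)²`, with `A_j = a_j a_j*` and
`y_j = x* A_j x`, namely `(1 / N) ∑ j, (z* A_j z - y_j) A_j z`. -/
def wirtingerGrad {𝕜 : Type*} [RCLike 𝕜] {d N : ℕ} (a : Fin N → Signal 𝕜 d)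
    (x z : Signal 𝕜 d) : Signal 𝕜 d :=
  WithLp.toLp 2 ((1 / (N : 𝕜)) •
    ∑ j, (quad (outer (a j)) z - quad (outer (a j)) x) • (outer (a j) *ᵥ z.ofLp))

/-- The gradient iterates `z_{k+1} = z_k - ξ ∇E_x(z_k)` started at `z₀`. -/
def wirtingerFlow {𝕜 : Type*} [RCLike 𝕜] {d N : ℕ} (a : Fin N → Signal 𝕜 d)
    (x : Signal 𝕜 d) (ξ : ℝ) (z₀ : Signal 𝕜 d) : ℕ → Signal 𝕜 d
  | 0 => z₀
  | k + 1 => wirtingerFlow a x ξ z₀ k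
      - (ξ : 𝕜) • wirtingerGrad a x (wirtingerFlow a x ξ z₀ k)

/-- `α = τ₂ + τ₃ - (τ₄)₋`, where `t₋ = max (-t) 0`. -/
def alphaConst (τ₂ τ₃ τ₄ : ℝ) : ℝ := τ₂ + τ₃ - max (-τ₄) 0

/-- `β = τ₃ - (τ₄)₋`. -/
def betaConst (τ₃ τ₄ : ℝ) : ℝ := τ₃ - max (-τ₄) 0

/-- `α̂ = τ₂ + τ₃ + |τ₄|`. -/
def alphaHat (τ₂ τ₃ τ₄ : ℝ) : ℝ := τ₂ + τ₃ + |τ₄|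

/-- The radius `ε₀ = 10 / (27 α) * (√(36 |τ₄|² + 27 α β / 10) - 6 |τ₄|)`. -/
def epsZero (τ₂ τ₃ τ₄ : ℝ) : ℝ :=
  10 / (27 * alphaConst τ₂ τ₃ τ₄) *
    (Real.sqrt (36 * |τ₄| ^ 2 + 27 * alphaConst τ₂ τ₃ τ₄ * betaConst τ₃ τ₄ / 10) - 6 * |τ₄|)

/-- The constant `R` that bounds the step size by `2 / R`. -/
def stepConst (d N : ℕ) (δ τ₁ τ₂ τ₃ τ₄ : ℝ) : ℝ :=
  max (96 * (alphaHat τ₂ τ₃ τ₄ ^ 2 * (1 + δ ^ 2) / (betaConst τ₃ τ₄ - δ)))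
    (270 * alphaHat τ₂ τ₃ τ₄ * (1 + δ)
      + 60 * d * Real.log N * τ₁ * (1 + δ) * epsZero τ₂ τ₃ τ₄ ^ 2)

end

end PhaseRetrieval

open PhaseRetrieval

/-! Rotate z so that h = z - x has h*x real, and put r_j = Re(h* A_j x), q_j = |a_j* h|². Then Re⟨h,
∇E(x+h)⟩ is the average of 2r_j² + 3r_j q_j + q_j². If the gradient satisfies ‖∇E‖² ≤ R(Re⟨h,∇E⟩ -
(β-δ)‖h‖²/8), a step ξ ≤ 2/R multiplies dist² by at most 1 - ξ(β-δ)/4 (`phaseDist_step_le`). The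
distance then does not grow, so the iterates never leave the ball of radius ε₀.

The difficulty is to bound the average from below uniformly in h: r_j q_j and q_j² are quartic in
a_j and need not have exponential moments. The identity 2r² + 3rq + q² = (5/2)(r + 3q/5)² - r²/2 +
q²/10 avoids this. The first square only needs a lower bound, and a nonnegative variable has a
harmless lower tail (`exists_forall_le_avg_bil_sq`). The term r²/2 needs an upper bound, but with x
fixed, so |a_j* x|² can be truncated at order log N (`exists_forall_avg_bil_sq_le`). The term q²/10
is never estimated: it pays for the quartic part of ‖∇E‖² (`norm_sq_wirtingerGrad_le`).

In expectation the first two terms are explicit by the moment conditions, and they are at least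
(β/2)‖h‖² as long as ‖h‖ ≤ ε₀ (`HasMoments.le_integral_curvature`).

Uniformity comes from Chernoff bounds at the points of a net of scale N⁻⁶. Truncation forces an
exponential parameter of order 1/log N, so an exponent of order N/log N must beat a net entropy of
order d log N. This is N ≳ d log² N, which follows from N ≳ d log² d. The failure probability 7N⁻⁴
is below d⁻³. For bounded d the constant c makes the claimed probability negative. -/

namespace PhaseRetrieval

/-! ### Empirical averages. -/

section Averages

/-- The empirical average of a finite family of reals. -/
noncomputable def avg {N : ℕ} (f : Fin N → ℝ) : ℝ := (N : ℝ)⁻¹ * ∑ j, f j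

variable {N : ℕ} (f g : Fin N → ℝ)

theorem avg_add : avg (fun j => f j + g j) = avg f + avg g := by
  simp [avg, Finset.sum_add_distrib, mul_add]

theorem avg_sub : avg (fun j => f j - g j) = avg f - avg g := by
  simp [avg, Finset.sum_sub_distrib, mul_sub]

theorem avg_const_mul (c : ℝ) : avg (fun j => c * f j) = c * avg f := by
  simp only [avg, ← Finset.mul_sum]; ring

theorem avg_neg : avg (fun j => -f j) = -avg f := by
  simp [avg]

theorem avg_mono {f g : Fin N → ℝ} (h : ∀ j, f j ≤ g j) : avg f ≤ avg g :=
  mul_le_mul_of_nonneg_left (Finset.sum_le_sum fun j _ => h j) (by positivity)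

theorem avg_nonneg {f : Fin N → ℝ} (h : ∀ j, 0 ≤ f j) : 0 ≤ avg f :=
  mul_nonneg (by positivity) (Finset.sum_nonneg fun j _ => h j)

theorem avg_const_le {c : ℝ} (hc : 0 ≤ c) : avg (fun _ : Fin N => c) ≤ c := by
  rcases Nat.eq_zero_or_pos N with rfl | hN
  · simpa [avg] using hc
  · have : (N : ℝ) ≠ 0 := by positivity
    simp [avg, this]

/-- The Cauchy-Schwarz inequality for empirical averages. -/
theorem avg_mul_le : avg (fun j => f j * g j) ≤
    √(avg fun j => f j ^ 2) * √(avg fun j => g j ^ 2) := by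
  have h := Real.sum_mul_le_sqrt_mul_sqrt Finset.univ f g
  simp only [avg]
  rw [Real.sqrt_mul (by positivity), Real.sqrt_mul (by positivity)]
  calc (N : ℝ)⁻¹ * ∑ j, f j * g j ≤ (N : ℝ)⁻¹ * (√(∑ j, f j ^ 2) * √(∑ j, g j ^ 2)) := by gcongr
    _ = √((N : ℝ)⁻¹) * √((N : ℝ)⁻¹) * (√(∑ j, f j ^ 2) * √(∑ j, g j ^ 2)) := by
        rw [Real.mul_self_sqrt (by positivity)]
    _ = _ := by ring

theorem avg_mul_le_of_le {A B : ℝ} (hf : avg (fun j => f j ^ 2) ≤ A)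
    (hg : avg (fun j => g j ^ 2) ≤ B) : avg (fun j => f j * g j) ≤ √A * √B :=
  (avg_mul_le f g).trans (by gcongr)

end Averages

/-! ### The form Re(h* a a* y). -/

section Bilinear

variable {𝕜 : Type*} [RCLike 𝕜] {d : ℕ}

/-- The real bilinear form `(h, y) ↦ Re (h* a a* y)`. -/
noncomputable def bil (a h y : Signal 𝕜 d) : ℝ := RCLike.re (inner 𝕜 h a * inner 𝕜 a y)

variable (a h k x y : Signal 𝕜 d)

theorem bil_self : bil a h h = ‖inner 𝕜 a h‖ ^ 2 := by
  rw [bil, inner_mul_symm_re_eq_norm, norm_mul, norm_inner_symm h a, sq]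

theorem bil_comm : bil a h y = bil a y h := by
  rw [bil, bil, ← RCLike.conj_re, map_mul, inner_conj_symm, inner_conj_symm, mul_comm]

theorem bil_add_left : bil a (h + k) y = bil a h y + bil a k y := by
  simp [bil, inner_add_left, add_mul]

theorem bil_add_right : bil a h (x + y) = bil a h x + bil a h y := by
  rw [bil_comm, bil_add_left, bil_comm a x, bil_comm a y]

theorem bil_smul_left (c : ℝ) : bil a ((c : 𝕜) • h) y = c * bil a h y := by
  rw [bil, inner_smul_left, RCLike.conj_ofReal, mul_assoc, RCLike.re_ofReal_mul, bil]

theorem bil_real_smul_left (c : ℝ) : bil a (c • h) y = c * bil a h y := by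
  rw [← bil_smul_left, RCLike.real_smul_eq_coe_smul (K := 𝕜)]

theorem bil_real_smul_right (c : ℝ) : bil a h (c • y) = c * bil a h y := by
  rw [bil_comm, bil_real_smul_left, bil_comm]

theorem bil_sub_left : bil a (h - k) y = bil a h y - bil a k y := by
  simp [bil, inner_sub_left, sub_mul]

theorem bil_sub_right : bil a h (x - y) = bil a h x - bil a h y := by
  rw [bil_comm, bil_sub_left, bil_comm a x, bil_comm a y]

theorem abs_bil_le : |bil a h y| ≤ ‖inner 𝕜 a h‖ * ‖inner 𝕜 a y‖ := by
  rw [bil]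
  refine (RCLike.abs_re_le_norm _).trans ?_
  rw [norm_mul, norm_inner_symm h a]

theorem abs_bil_le_norm : |bil a h y| ≤ ‖a‖ ^ 2 * ‖h‖ * ‖y‖ := by
  refine (abs_bil_le a h y).trans ?_
  calc ‖inner 𝕜 a h‖ * ‖inner 𝕜 a y‖ ≤ (‖a‖ * ‖h‖) * (‖a‖ * ‖y‖) := by
        gcongr <;> exact norm_inner_le_norm _ _
    _ = _ := by ring

theorem norm_inner_add_sq : ‖inner 𝕜 a (x + h)‖ ^ 2 =
    ‖inner 𝕜 a x‖ ^ 2 + 2 * bil a h x + ‖inner 𝕜 a h‖ ^ 2 := by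
  rw [← bil_self, bil_add_left, bil_add_right, bil_add_right, bil_self, bil_self, bil_comm a x h]
  ring

theorem norm_inner_sub_sq : ‖inner 𝕜 a (x - h)‖ ^ 2 =
    ‖inner 𝕜 a x‖ ^ 2 - 2 * bil a h x + ‖inner 𝕜 a h‖ ^ 2 := by
  rw [← bil_self, bil_sub_left, bil_sub_right, bil_sub_right, bil_self, bil_self, bil_comm a x h]
  ring

/-- The modulus of `h* a a* y` splits into real and imaginary parts. -/
theorem bil_sq_add_bil_I_sq :
    bil a h y ^ 2 + bil a ((RCLike.I : 𝕜) • h) y ^ 2 =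
      ‖inner 𝕜 a h‖ ^ 2 * ‖inner 𝕜 a y‖ ^ 2 := by
  have h1 : ‖inner 𝕜 h a * inner 𝕜 a y‖ ^ 2 = ‖inner 𝕜 a h‖ ^ 2 * ‖inner 𝕜 a y‖ ^ 2 := by
    rw [norm_mul, mul_pow, norm_inner_symm]
  rw [← h1, ← RCLike.normSq_eq_def', RCLike.normSq_apply]
  simp only [bil, inner_smul_left, mul_assoc]
  simp only [RCLike.mul_re, RCLike.conj_I, map_neg, RCLike.I_re, RCLike.mul_im]
  rcases RCLike.I_mul_I_ax (K := 𝕜) with hI | hI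
  · have : ∀ w : 𝕜, RCLike.im w = 0 := fun w => by
      have := RCLike.mul_im_I_ax w
      simpa [hI] using this.symm
    simp [this, hI]
    ring
  · have hI' : RCLike.im (RCLike.I : 𝕜) = 1 := by
      have h2 := congrArg RCLike.re hI
      have h3 := RCLike.mul_im_I_ax (RCLike.I : 𝕜)
      rw [RCLike.mul_re, RCLike.I_re, h3] at h2
      simpa using h2
    simp [hI']
    ring

end Bilinear

/-! ### The Wirtinger gradient in terms of inner products. -/

section Gradient

variable {𝕜 : Type*} [RCLike 𝕜] {d N : ℕ}

theorem outer_mulVec (a z : Signal 𝕜 d) : outer a *ᵥ z.ofLp = inner 𝕜 a z • a.ofLp := by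
  ext m
  simp only [Matrix.mulVec, dotProduct, outer, Matrix.of_apply, Pi.smul_apply, smul_eq_mul,
    PiLp.inner_apply, RCLike.inner_apply, Finset.sum_mul]
  exact Finset.sum_congr rfl fun i _ => by simp; ring

theorem quad_outer (a z : Signal 𝕜 d) : quad (outer a) z = ((‖inner 𝕜 a z‖ ^ 2 : ℝ) : 𝕜) := by
  have h1 : star z.ofLp ⬝ᵥ a.ofLp = inner 𝕜 z a := by
    simp [dotProduct, PiLp.inner_apply, mul_comm]
  rw [quad, outer_mulVec, dotProduct_smul, h1, smul_eq_mul, ← inner_conj_symm, RCLike.conj_mul]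
  simp [norm_inner_symm]

theorem wirtingerGrad_eq (a : Fin N → Signal 𝕜 d) (x z : Signal 𝕜 d) :
    wirtingerGrad a x z = (((N : ℝ)⁻¹ : ℝ) : 𝕜) •
      ∑ j, (((‖inner 𝕜 (a j) z‖ ^ 2 - ‖inner 𝕜 (a j) x‖ ^ 2 : ℝ)) : 𝕜) •
        (inner 𝕜 (a j) z • a j) := by
  ext m
  simp [wirtingerGrad, quad_outer, outer_mulVec]

theorem re_inner_wirtingerGrad (a : Fin N → Signal 𝕜 d) (u x z : Signal 𝕜 d) :
    RCLike.re (inner 𝕜 u (wirtingerGrad a x z)) =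
      avg fun j => (‖inner 𝕜 (a j) z‖ ^ 2 - ‖inner 𝕜 (a j) x‖ ^ 2) * bil (a j) u z := by
  rw [wirtingerGrad_eq, inner_smul_right, RCLike.re_ofReal_mul, inner_sum, map_sum, avg]
  congr 1
  refine Finset.sum_congr rfl fun j _ => ?_
  rw [inner_smul_right, RCLike.re_ofReal_mul, inner_smul_right, bil, mul_comm (inner 𝕜 u (a j))]

/-- Equivariance under phases allows each step to be analysed after rotating z to the best phase. -/
theorem wirtingerGrad_phase (a : Fin N → Signal 𝕜 d) (x z : Signal 𝕜 d) {u : 𝕜} (hu : ‖u‖ = 1) :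
    wirtingerGrad a x (u • z) = u • wirtingerGrad a x z := by
  simp only [wirtingerGrad_eq, inner_smul_right, norm_mul, hu, one_mul, Finset.smul_sum, smul_smul]
  refine Finset.sum_congr rfl fun j _ => ?_
  congr 1
  ring

end Gradient

/-! ### Distance to the orbit of x. -/

section Phase

variable {𝕜 : Type*} [RCLike 𝕜] {d : ℕ}

theorem phaseDist_le (z x : Signal 𝕜 d) {u : 𝕜} (hu : ‖u‖ = 1) : phaseDist z x ≤ ‖z - u • x‖ :=
  ciInf_le (f := fun u : Metric.sphere (0 : 𝕜) 1 => ‖z - (u : 𝕜) • x‖)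
    ⟨0, by rintro _ ⟨v, rfl⟩; positivity⟩ ⟨u, by simpa using hu⟩

theorem phaseDist_nonneg (z x : Signal 𝕜 d) : 0 ≤ phaseDist z x :=
  Real.iInf_nonneg fun _ => norm_nonneg _

/-- The distance to the orbit is attained at a phase for which the inner product is real. -/
theorem exists_phaseDist_eq (z x : Signal 𝕜 d) :
    ∃ u : 𝕜, ‖u‖ = 1 ∧ phaseDist z x = ‖z - u • x‖ ∧ RCLike.im (inner 𝕜 z (u • x)) = 0 := by
  obtain ⟨u, hu, hu'⟩ : ∃ u : 𝕜, ‖u‖ = 1 ∧ u * inner 𝕜 z x = (‖inner 𝕜 z x‖ : 𝕜) := by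
    by_cases hc : inner 𝕜 z x = 0
    · exact ⟨1, by simp, by simp [hc]⟩
    · have hn : (‖inner 𝕜 z x‖ : 𝕜) ≠ 0 := by simpa using hc
      refine ⟨starRingEnd 𝕜 (inner 𝕜 z x) / ‖inner 𝕜 z x‖, ?_, ?_⟩
      · rw [norm_div, RCLike.norm_conj, RCLike.norm_ofReal, abs_norm, div_self (by simpa using hc)]
      · rw [div_mul_eq_mul_div, RCLike.conj_mul, sq, mul_div_assoc, div_self hn, mul_one]
  refine ⟨u, hu, le_antisymm (phaseDist_le z x hu) ?_, ?_⟩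
  · have : Nonempty (Metric.sphere (0 : 𝕜) 1) := ⟨⟨1, by simp⟩⟩
    refine le_ciInf fun ⟨v, hv⟩ => ?_
    have hv' : ‖v‖ = 1 := by simpa using hv
    refine (sq_le_sq₀ (norm_nonneg _) (norm_nonneg _)).1 ?_
    rw [norm_sub_sq (𝕜 := 𝕜), norm_sub_sq (𝕜 := 𝕜), norm_smul, norm_smul, hu, hv', inner_smul_right,
      inner_smul_right, hu', RCLike.ofReal_re]
    have : RCLike.re (v * inner 𝕜 z x) ≤ ‖inner 𝕜 z x‖ := by
      refine (RCLike.re_le_norm _).trans ?_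
      rw [norm_mul, hv', one_mul]
    linarith
  · rw [inner_smul_right, hu', RCLike.ofReal_im]

end Phase

/-! ### Deterministic contraction from curvature and smoothness bounds. -/

section Descent

variable {𝕜 : Type*} [RCLike 𝕜] {d N : ℕ}

/-- Test the gradient g against itself. The four resulting averages are bounded by Cauchy-Schwarz,
giving ‖g‖ ≤ 2W‖h‖ + √S(3√W + √V). The quartic average S stays on the right side because the
curvature bound contains S/10 to pay for it. -/
theorem norm_sq_wirtingerGrad_le (a : Fin N → Signal 𝕜 d) (x h : Signal 𝕜 d) {W V : ℝ}
    (hW0 : 0 ≤ W) (hV0 : 0 ≤ V)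
    (hW : ∀ u, avg (fun j => ‖inner 𝕜 (a j) u‖ ^ 2 * ‖inner 𝕜 (a j) x‖ ^ 2) ≤ W * ‖u‖ ^ 2)
    (hV : ∀ u, avg (fun j => ‖inner 𝕜 (a j) u‖ ^ 2 * ‖inner 𝕜 (a j) h‖ ^ 2) ≤ V * ‖u‖ ^ 2) :
    ‖wirtingerGrad a x (x + h)‖ ^ 2 ≤ 16 * W ^ 2 * ‖h‖ ^ 2 +
      (24 * W + 8 / 3 * V) * avg fun j => (‖inner 𝕜 (a j) h‖ ^ 2) ^ 2 := by
  set g := wirtingerGrad a x (x + h) with hg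
  set S := avg fun j => (‖inner 𝕜 (a j) h‖ ^ 2) ^ 2 with hS
  have hS0 : 0 ≤ S := avg_nonneg fun j => by positivity
  have hr : ∀ u, avg (fun j => bil (a j) u x ^ 2) ≤ W * ‖u‖ ^ 2 := fun u =>
    (avg_mono fun j => by
      rw [← mul_pow, ← sq_abs (bil _ _ _)]
      exact pow_le_pow_left₀ (abs_nonneg _) (abs_bil_le _ _ _) 2).trans (hW u)
  have key : ‖g‖ ^ 2 ≤ ‖g‖ * (2 * W * ‖h‖ + √S * (3 * √W + √V)) := by
    have hsplit : ‖g‖ ^ 2 = 2 * avg (fun j => bil (a j) h x * bil (a j) g x) +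
        avg (fun j => ‖inner 𝕜 (a j) h‖ ^ 2 * bil (a j) g x) +
        2 * avg (fun j => bil (a j) h x * bil (a j) g h) +
        avg (fun j => ‖inner 𝕜 (a j) h‖ ^ 2 * bil (a j) g h) := by
      rw [← avg_const_mul, ← avg_const_mul, ← avg_add, ← avg_add, ← avg_add,
        ← inner_self_eq_norm_sq (𝕜 := 𝕜) g]
      conv_lhs => rw [hg, re_inner_wirtingerGrad, ← hg]
      congr 1
      funext j
      rw [norm_inner_add_sq, bil_add_right]
      ring
    have sq_mul : ∀ c : ℝ, 0 ≤ c → √(c * ‖g‖ ^ 2) = √c * ‖g‖ := fun c hc => by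
      rw [Real.sqrt_mul hc, Real.sqrt_sq (norm_nonneg _)]
    have h1 : avg (fun j => bil (a j) h x * bil (a j) g x) ≤ W * ‖h‖ * ‖g‖ := by
      refine (avg_mul_le_of_le _ _ (hr h) (hr g)).trans_eq ?_
      rw [sq_mul W hW0, Real.sqrt_mul hW0, Real.sqrt_sq (norm_nonneg _)]
      linear_combination ‖h‖ * ‖g‖ * Real.mul_self_sqrt hW0
    have h2 : avg (fun j => ‖inner 𝕜 (a j) h‖ ^ 2 * bil (a j) g x) ≤ √S * (√W * ‖g‖) := by
      refine (avg_mul_le_of_le _ _ le_rfl (hr g)).trans_eq ?_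
      rw [sq_mul W hW0]
    have h3 : avg (fun j => bil (a j) h x * bil (a j) g h) ≤ √S * (√W * ‖g‖) := by
      rw [← sq_mul W hW0]
      refine le_trans (avg_mono fun j => ?_) (avg_mul_le_of_le
        (fun j => ‖inner 𝕜 (a j) h‖ ^ 2) (fun j => ‖inner 𝕜 (a j) g‖ * ‖inner 𝕜 (a j) x‖) le_rfl
        (by simpa only [mul_pow] using hW g))
      refine (le_abs_self _).trans ?_
      rw [abs_mul]
      calc _ ≤ (‖inner 𝕜 (a j) h‖ * ‖inner 𝕜 (a j) x‖) * (‖inner 𝕜 (a j) g‖ * ‖inner 𝕜 (a j) h‖) :=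
            mul_le_mul (abs_bil_le _ _ _) (abs_bil_le _ _ _) (abs_nonneg _) (by positivity)
        _ = _ := by ring
    have h4 : avg (fun j => ‖inner 𝕜 (a j) h‖ ^ 2 * bil (a j) g h) ≤ √S * (√V * ‖g‖) := by
      rw [← sq_mul V hV0]
      refine le_trans (avg_mono fun j => ?_) (avg_mul_le_of_le
        (fun j => ‖inner 𝕜 (a j) h‖ ^ 2) (fun j => ‖inner 𝕜 (a j) g‖ * ‖inner 𝕜 (a j) h‖) le_rfl
        (by simpa only [mul_pow] using hV g))
      gcongr
      exact (le_abs_self _).trans (abs_bil_le _ _ _)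
    linarith
  have hle : ‖g‖ ≤ 2 * W * ‖h‖ + √S * (3 * √W + √V) := by
    rcases (norm_nonneg g).eq_or_lt with h0 | h0
    · rw [← h0]; positivity
    · refine le_of_mul_le_mul_left ?_ h0
      rwa [← sq]
  have hle2 : ‖g‖ ^ 2 ≤ (2 * W * ‖h‖ + √S * (3 * √W + √V)) ^ 2 :=
    pow_le_pow_left₀ (norm_nonneg _) hle 2
  have e1 := Real.sq_sqrt hS0
  have e2 := Real.sq_sqrt hW0
  have e3 := Real.sq_sqrt hV0
  have e4 : (3 * √W + √V) ^ 2 ≤ 18 * W + 2 * V := by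
    nlinarith [sq_nonneg (3 * √W - √V)]
  -- The unequal weights in (p+q)² ≤ 4p² + (4/3)q² favour the quartic part, whose coefficient enters
  -- the second condition on R.
  have e5 : (2 * W * ‖h‖ + √S * (3 * √W + √V)) ^ 2 ≤
      4 * (2 * W * ‖h‖) ^ 2 + 4 / 3 * (√S * (3 * √W + √V)) ^ 2 := by
    nlinarith [sq_nonneg (3 * (2 * W * ‖h‖) - √S * (3 * √W + √V))]
  rw [mul_pow (√S), e1] at e5
  nlinarith [mul_le_mul_of_nonneg_left e4 hS0]

/-- One step of the gradient iteration contracts the distance to the orbit of `x`. -/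
theorem phaseDist_step_le (a : Fin N → Signal 𝕜 d) (x : Signal 𝕜 d) {ε b R W V : ℝ}
    (hR : 0 < R) (hW0 : 0 ≤ W) (hV0 : 0 ≤ V) (hb : 0 ≤ b)
    (hR1 : 128 / 3 * W ^ 2 ≤ R * b) (hR2 : 240 * W + 80 / 3 * V ≤ R)
    (hW : ∀ u, avg (fun j => ‖inner 𝕜 (a j) u‖ ^ 2 * ‖inner 𝕜 (a j) x‖ ^ 2) ≤ W * ‖u‖ ^ 2)
    (hV : ∀ h u, ‖h‖ ≤ ε →
      avg (fun j => ‖inner 𝕜 (a j) u‖ ^ 2 * ‖inner 𝕜 (a j) h‖ ^ 2) ≤ V * ‖u‖ ^ 2)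
    (hcurv : ∀ h, ‖h‖ ≤ ε → RCLike.im (inner 𝕜 h x) = 0 →
      b / 2 * ‖h‖ ^ 2 + (avg fun j => (‖inner 𝕜 (a j) h‖ ^ 2) ^ 2) / 10 ≤
        avg fun j => 2 * bil (a j) h x ^ 2 + 3 * (bil (a j) h x * ‖inner 𝕜 (a j) h‖ ^ 2) +
          (‖inner 𝕜 (a j) h‖ ^ 2) ^ 2)
    {z : Signal 𝕜 d} (hz : phaseDist z x ≤ ε) {ξ : ℝ} (hξ : 0 < ξ) (hξR : ξ ≤ 2 / R) :
    phaseDist (z - (ξ : 𝕜) • wirtingerGrad a x z) x ^ 2 ≤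
      (1 - ξ * b / 4) * phaseDist z x ^ 2 := by
  obtain ⟨u, hu, hdist, him⟩ := exists_phaseDist_eq z x
  have huu : u * starRingEnd 𝕜 u = 1 := by rw [RCLike.mul_conj, hu]; simp
  set h := starRingEnd 𝕜 u • z - x with hh
  have hz' : z = u • (x + h) := by
    rw [hh, add_sub_cancel, smul_smul, huu, one_smul]
  have hzh : z - u • x = u • h := by rw [hz', smul_add, add_sub_cancel_left]
  have hnorm : phaseDist z x = ‖h‖ := by rw [hdist, hzh, norm_smul, hu, one_mul]
  have himh : RCLike.im (inner 𝕜 h x) = 0 := by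
    rw [hh, inner_sub_left, inner_smul_left, RCLike.conj_conj, ← inner_smul_right, map_sub, him,
      inner_self_im, sub_zero]
  set g := wirtingerGrad a x (x + h) with hg
  have hstep : z - (ξ : 𝕜) • wirtingerGrad a x z - u • x = u • (h - (ξ : 𝕜) • g) := by
    have hgz : wirtingerGrad a x z = u • g := by
      have := wirtingerGrad_phase a x (x + h) hu
      rwa [← hz'] at this
    rw [sub_right_comm, hzh, hgz, smul_comm (ξ : 𝕜) u g, ← smul_sub]
  have h1 : phaseDist (z - (ξ : 𝕜) • wirtingerGrad a x z) x ^ 2 ≤ ‖h - (ξ : 𝕜) • g‖ ^ 2 := by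
    refine pow_le_pow_left₀ (phaseDist_nonneg _ _) ((phaseDist_le _ x hu).trans_eq ?_) 2
    rw [hstep, norm_smul, hu, one_mul]
  have h2 : ‖h - (ξ : 𝕜) • g‖ ^ 2 =
      ‖h‖ ^ 2 - 2 * ξ * RCLike.re (inner 𝕜 h g) + ξ ^ 2 * ‖g‖ ^ 2 := by
    rw [norm_sub_sq (𝕜 := 𝕜), inner_smul_right, RCLike.re_ofReal_mul, norm_smul,
      RCLike.norm_ofReal, mul_pow, sq_abs]
    ring
  have hε : ‖h‖ ≤ ε := hnorm ▸ hz
  have hc := hcurv h hε himh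
  set S := avg fun j => (‖inner 𝕜 (a j) h‖ ^ 2) ^ 2 with hS
  have hS0 : 0 ≤ S := avg_nonneg fun j => by positivity
  have hinner : RCLike.re (inner 𝕜 h g) = avg fun j => 2 * bil (a j) h x ^ 2 +
      3 * (bil (a j) h x * ‖inner 𝕜 (a j) h‖ ^ 2) + (‖inner 𝕜 (a j) h‖ ^ 2) ^ 2 := by
    rw [hg, re_inner_wirtingerGrad]
    congr 1
    funext j
    rw [norm_inner_add_sq, bil_add_right, bil_self]
    ring
  rw [← hinner] at hc
  have hgn : ‖g‖ ^ 2 ≤ _ := norm_sq_wirtingerGrad_le a x h hW0 hV0 hW (fun u => hV h u hε)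
  rw [← hS] at hgn
  -- Of the curvature (b/2)‖h‖² + S/10, the part (3b/8)‖h‖² pays for the W² term and S/10 for the
  -- quartic term; (b/8)‖h‖² is left over and becomes the contraction rate.
  have h3 : ‖g‖ ^ 2 ≤ R * (RCLike.re (inner 𝕜 h g) - b / 8 * ‖h‖ ^ 2) := by
    have e1 : 16 * W ^ 2 * ‖h‖ ^ 2 ≤ R * (3 / 8 * b) * ‖h‖ ^ 2 :=
      mul_le_mul_of_nonneg_right (by linarith) (sq_nonneg _)
    have e2 : (24 * W + 8 / 3 * V) * S ≤ R * (1 / 10) * S :=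
      mul_le_mul_of_nonneg_right (by linarith) hS0
    have e3 : R * (b / 2 * ‖h‖ ^ 2 + S / 10) ≤ R * RCLike.re (inner 𝕜 h g) := by gcongr
    linarith
  have h4 : ξ ^ 2 * ‖g‖ ^ 2 ≤ 2 * ξ * (RCLike.re (inner 𝕜 h g) - b / 8 * ‖h‖ ^ 2) := by
    have hξR' : ξ * R ≤ 2 := (le_div_iff₀ hR).1 hξR
    have hpos : 0 ≤ RCLike.re (inner 𝕜 h g) - b / 8 * ‖h‖ ^ 2 := by
      nlinarith [mul_nonneg hb (sq_nonneg ‖h‖)]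
    calc ξ ^ 2 * ‖g‖ ^ 2 ≤ ξ ^ 2 * (R * (RCLike.re (inner 𝕜 h g) - b / 8 * ‖h‖ ^ 2)) := by gcongr
      _ = ξ * (ξ * R) * (RCLike.re (inner 𝕜 h g) - b / 8 * ‖h‖ ^ 2) := by ring
      _ ≤ ξ * 2 * (RCLike.re (inner 𝕜 h g) - b / 8 * ‖h‖ ^ 2) := by gcongr
      _ = _ := by ring
  rw [hnorm]
  linarith

/-- The one-step factor is at most 1, so by induction every iterate stays in the ball where the
one-step estimate is valid. -/
theorem phaseDist_flow_le (a : Fin N → Signal 𝕜 d) (x : Signal 𝕜 d) (hx : ‖x‖ = 1)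
    {ε b R W V : ℝ}
    (hR : 0 < R) (hW0 : 0 ≤ W) (hV0 : 0 ≤ V) (hb : 0 ≤ b)
    (hR1 : 128 / 3 * W ^ 2 ≤ R * b) (hR2 : 240 * W + 80 / 3 * V ≤ R)
    (hW : ∀ u, avg (fun j => ‖inner 𝕜 (a j) u‖ ^ 2 * ‖inner 𝕜 (a j) x‖ ^ 2) ≤ W * ‖u‖ ^ 2)
    (hV : ∀ h u, ‖h‖ ≤ ε →
      avg (fun j => ‖inner 𝕜 (a j) u‖ ^ 2 * ‖inner 𝕜 (a j) h‖ ^ 2) ≤ V * ‖u‖ ^ 2)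
    (hcurv : ∀ h, ‖h‖ ≤ ε → RCLike.im (inner 𝕜 h x) = 0 →
      b / 2 * ‖h‖ ^ 2 + (avg fun j => (‖inner 𝕜 (a j) h‖ ^ 2) ^ 2) / 10 ≤
        avg fun j => 2 * bil (a j) h x ^ 2 + 3 * (bil (a j) h x * ‖inner 𝕜 (a j) h‖ ^ 2) +
          (‖inner 𝕜 (a j) h‖ ^ 2) ^ 2)
    {z : Signal 𝕜 d} (hz : z ∈ nbhd x ε) {ξ : ℝ} (hξ : 0 < ξ) (hξR : ξ ≤ 2 / R) (k : ℕ) :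
    phaseDist (wirtingerFlow a x ξ z (k + 1)) x ^ 2 ≤
      (1 - ξ * b / 4) * phaseDist (wirtingerFlow a x ξ z k) x ^ 2 := by
  have hz' : phaseDist z x ≤ ε := by simpa [nbhd, hx] using hz
  have hstep : ∀ w : Signal 𝕜 d, phaseDist w x ≤ ε → _ := fun w hw =>
    phaseDist_step_le a x hR hW0 hV0 hb hR1 hR2 hW hV hcurv hw hξ hξR
  have hmem : ∀ k, phaseDist (wirtingerFlow a x ξ z k) x ≤ ε := by
    intro k
    induction k with
    | zero => exact hz'
    | succ k ih =>
      refine le_trans ?_ ih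
      refine (sq_le_sq₀ (phaseDist_nonneg _ _) (phaseDist_nonneg _ _)).1 ?_
      refine (hstep _ ih).trans ?_
      have : 0 ≤ ξ * b / 4 * phaseDist (wirtingerFlow a x ξ z k) x ^ 2 := by positivity
      linarith
  exact hstep _ (hmem k)

end Descent

/-! ### From the ψ₂ norm to square exponential moments. -/

section SubGaussian

variable {𝕜 Ω : Type*} [RCLike 𝕜] [MeasurableSpace Ω] {d : ℕ} {μ : Measure Ω}

/-- A random vector whose marginals in directions `v` with `‖v‖ ≤ 4` have square exponential
moments of order `l`, bounded by `2`. -/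
structure HasSqExpMoment (μ : Measure Ω) (b : Ω → Signal 𝕜 d) (l : ℝ) : Prop where
  pos : 0 < l
  aemeasurable : AEMeasurable b μ
  lintegral_le : ∀ v : Signal 𝕜 d, ‖v‖ ≤ 4 →
    ∫⁻ ω, ENNReal.ofReal (Real.exp (l * ‖inner 𝕜 (b ω) v‖ ^ 2)) ∂μ ≤ 2

theorem ofReal_exp_eq_tsum {y : ℝ} (hy : 0 ≤ y) :
    ENNReal.ofReal (Real.exp y) = ∑' n : ℕ, ENNReal.ofReal (y ^ n / n.factorial) := by
  rw [← ENNReal.ofReal_tsum_of_nonneg (fun n => by positivity) (Real.summable_pow_div_factorial y),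
    Real.exp_eq_exp_ℝ, NormedSpace.exp_eq_tsum_div]

theorem aemeasurable_inner {b : Ω → Signal 𝕜 d} (hb : AEMeasurable b μ) (v : Signal 𝕜 d) :
    AEMeasurable (fun ω => inner 𝕜 (b ω) v) μ :=
  (continuous_id.inner continuous_const : Continuous fun a : Signal 𝕜 d =>
    inner 𝕜 a v).measurable.comp_aemeasurable hb

theorem lintegral_enorm_pow_le_of_psiTwoNorm_le {b : Ω → Signal 𝕜 d} {K : ℝ≥0}
    (hK : psiTwoNorm μ b ≤ K) {v : Signal 𝕜 d} (hv : ‖v‖ = 1) {n : ℕ} (hn : 1 ≤ n) :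
    ∫⁻ ω, ENNReal.ofReal (‖inner 𝕜 (b ω) v‖ ^ (2 * n)) ∂μ ≤
      ENNReal.ofReal (((K : ℝ) ^ 2 * (2 * n)) ^ n) := by
  have hp : (1 : ℝ) ≤ 2 * n := by
    have : (1 : ℝ) ≤ n := by exact_mod_cast hn
    linarith
  have h1 : eLpNorm (fun ω => inner 𝕜 (b ω) v) (ENNReal.ofReal (2 * n)) μ /
      ENNReal.ofReal (√(2 * n)) ≤ K := by
    refine le_trans ?_ hK
    refine le_iSup₂_of_le (f := fun (v : Signal 𝕜 d) (_ : ‖v‖ = 1) => _) v hv ?_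
    exact le_iSup₂_of_le (f := fun (p : ℝ) (_ : 1 ≤ p) =>
      eLpNorm (fun ω => inner 𝕜 (b ω) v) (ENNReal.ofReal p) μ / ENNReal.ofReal (√p))
      (2 * n) hp le_rfl
  have hs : 0 < √(2 * (n : ℝ)) := Real.sqrt_pos.2 (by linarith)
  have h2 : eLpNorm (fun ω => inner 𝕜 (b ω) v) (ENNReal.ofReal (2 * n)) μ ≤
      ENNReal.ofReal (K * √(2 * n)) := by
    rw [ENNReal.div_le_iff (by simpa using hs) ENNReal.ofReal_ne_top] at h1
    rwa [ENNReal.ofReal_mul (p := (K : ℝ)) K.coe_nonneg, ENNReal.ofReal_coe_nnreal]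
  have hq : ENNReal.ofReal (2 * n) = ((2 * n : ℕ) : ℝ≥0∞) := by
    rw [← ENNReal.ofReal_natCast]; push_cast; rfl
  rw [hq] at h2
  have h3 := eLpNorm_nnreal_pow_eq_lintegral (μ := μ) (f := fun ω => inner 𝕜 (b ω) v)
    (p := ((2 * n : ℕ) : ℝ≥0)) (by simp; omega)
  have h4 : ∀ ω, ENNReal.ofReal (‖inner 𝕜 (b ω) v‖ ^ (2 * n)) = ‖inner 𝕜 (b ω) v‖ₑ ^ (2 * n) :=
    fun ω => by rw [ENNReal.ofReal_pow (norm_nonneg _), ofReal_norm]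
  simp only [NNReal.coe_natCast, ENNReal.rpow_natCast, ENNReal.coe_natCast] at h3
  simp only [h4]
  rw [← h3]
  calc _ ≤ ENNReal.ofReal (K * √(2 * n)) ^ (2 * n) := by gcongr
    _ = _ := by
      rw [← ENNReal.ofReal_pow (by positivity), pow_mul, mul_pow, Real.sq_sqrt (by positivity)]

/-- Expand the exponential. The moment bound (2nK²)ⁿ together with nⁿ/n! ≤ eⁿ ≤ 3ⁿ makes the n-th
term at most (6lK²)ⁿ ≤ 2⁻ⁿ. -/
theorem lintegral_exp_le_two_of_psiTwoNorm_le [IsProbabilityMeasure μ] {b : Ω → Signal 𝕜 d}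
    (hb : AEMeasurable b μ) {K : ℝ≥0} (hK : psiTwoNorm μ b ≤ K) {v : Signal 𝕜 d} (hv : ‖v‖ = 1)
    {l : ℝ} (hl : 0 ≤ l) (hlK : 12 * (l * (K : ℝ) ^ 2) ≤ 1) :
    ∫⁻ ω, ENNReal.ofReal (Real.exp (l * ‖inner 𝕜 (b ω) v‖ ^ 2)) ∂μ ≤ 2 := by
  have hm : AEMeasurable (fun ω => ‖inner 𝕜 (b ω) v‖) μ := (aemeasurable_inner hb v).norm
  have h1 : ∀ ω, ENNReal.ofReal (Real.exp (l * ‖inner 𝕜 (b ω) v‖ ^ 2)) =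
      ∑' n : ℕ, ENNReal.ofReal (l ^ n / n.factorial) *
        ENNReal.ofReal (‖inner 𝕜 (b ω) v‖ ^ (2 * n)) := fun ω => by
    rw [ofReal_exp_eq_tsum (by positivity)]
    refine tsum_congr fun n => ?_
    rw [← ENNReal.ofReal_mul (by positivity), mul_pow, pow_mul]
    congr 1; ring
  simp only [h1]
  rw [lintegral_tsum fun n => (hm.pow_const _).ennreal_ofReal.const_mul _]
  refine le_trans (ENNReal.tsum_le_tsum fun n => ?_) ENNReal.tsum_geometric_two.le
  rw [lintegral_const_mul'' _ (hm.pow_const _).ennreal_ofReal]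
  rcases Nat.eq_zero_or_pos n with rfl | hn
  · simp
  · refine (mul_le_mul_right (lintegral_enorm_pow_le_of_psiTwoNorm_le hK hv hn) _).trans ?_
    rw [← ENNReal.ofReal_mul (by positivity)]
    have h2 : (2⁻¹ : ℝ≥0∞) ^ n = ENNReal.ofReal ((1 / 2) ^ n) := by
      rw [ENNReal.ofReal_pow (by norm_num)]
      congr 1
      rw [one_div, ENNReal.ofReal_inv_of_pos (by norm_num)]
      simp
    rw [h2]
    refine ENNReal.ofReal_le_ofReal ?_
    have h3 := Real.pow_div_factorial_le_exp (n : ℝ) (by positivity) n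
    have h4 : Real.exp n ≤ 3 ^ n := by
      rw [← Real.exp_one_pow]
      exact pow_le_pow_left₀ (Real.exp_pos _).le (Real.exp_one_lt_d9.le.trans (by norm_num)) _
    calc l ^ n / n.factorial * ((K : ℝ) ^ 2 * (2 * n)) ^ n
        = (2 * (l * (K : ℝ) ^ 2)) ^ n * ((n : ℝ) ^ n / n.factorial) := by
          simp only [mul_pow]; ring
      _ ≤ (2 * (l * (K : ℝ) ^ 2)) ^ n * 3 ^ n := by gcongr; exact h3.trans h4
      _ = (6 * (l * (K : ℝ) ^ 2)) ^ n := by rw [← mul_pow]; ring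
      _ ≤ (1 / 2) ^ n := pow_le_pow_left₀ (by positivity) (by linarith) _

theorem hasSqExpMoment_of_psiTwoNorm_le [IsProbabilityMeasure μ] {b : Ω → Signal 𝕜 d}
    (hb : AEMeasurable b μ) {K : ℝ≥0} (hK : psiTwoNorm μ b ≤ K) :
    HasSqExpMoment μ b (1 / (192 * ((K : ℝ) + 1) ^ 2)) where
  pos := by positivity
  aemeasurable := hb
  lintegral_le v hv := by
    set l : ℝ := 1 / (192 * ((K : ℝ) + 1) ^ 2) with hl
    by_cases hv0 : v = 0
    · simp [hv0]
    · have hn : ‖v‖ ≠ 0 := by simpa using hv0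
      set v₀ : Signal 𝕜 d := ((‖v‖⁻¹ : ℝ) : 𝕜) • v with hv₀
      have h1 : ‖v₀‖ = 1 := by
        rw [hv₀, norm_smul, RCLike.norm_ofReal, abs_inv, abs_norm, inv_mul_cancel₀ hn]
      have h2 : v = ((‖v‖ : ℝ) : 𝕜) • v₀ := by
        rw [hv₀, smul_smul, ← RCLike.ofReal_mul, mul_inv_cancel₀ hn]; simp
      -- Normalising a direction of length up to 4 replaces l by 16l, whence 192 = 12 · 16.
      refine le_trans (lintegral_mono fun ω => ?_)
        (lintegral_exp_le_two_of_psiTwoNorm_le hb hK h1 (l := 16 * l) (by positivity) ?_)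
      · refine ENNReal.ofReal_le_ofReal (Real.exp_le_exp.2 ?_)
        have h3 : ‖inner 𝕜 (b ω) v‖ ^ 2 = ‖v‖ ^ 2 * ‖inner 𝕜 (b ω) v₀‖ ^ 2 := by
          conv_lhs => rw [h2, inner_smul_right, norm_mul, RCLike.norm_ofReal, abs_norm, mul_pow]
        rw [h3]
        have : ‖v‖ ^ 2 ≤ 16 := by nlinarith [norm_nonneg v]
        have hl0 : 0 < l := by positivity
        nlinarith [mul_le_mul_of_nonneg_right this
          (mul_nonneg hl0.le (sq_nonneg ‖inner 𝕜 (b ω) v₀‖))]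
      · have h4 : l * (192 * ((K : ℝ) + 1) ^ 2) = 1 := by
          rw [hl]; field_simp
        have hl0 : 0 < l := by positivity
        have hK2 : (K : ℝ) ^ 2 ≤ ((K : ℝ) + 1) ^ 2 := by
          have := K.coe_nonneg; nlinarith
        nlinarith [mul_le_mul_of_nonneg_left hK2 hl0.le]

namespace HasSqExpMoment

variable {b : Ω → Signal 𝕜 d} {l : ℝ}

theorem aemeasurable_norm_inner (hb : HasSqExpMoment μ b l) (v : Signal 𝕜 d) :
    AEMeasurable (fun ω => ‖inner 𝕜 (b ω) v‖) μ :=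
  (aemeasurable_inner hb.aemeasurable v).norm

theorem integrable_exp (hb : HasSqExpMoment μ b l) {v : Signal 𝕜 d} (hv : ‖v‖ ≤ 4) :
    Integrable (fun ω => Real.exp (l * ‖inner 𝕜 (b ω) v‖ ^ 2)) μ := by
  refine ⟨(((hb.aemeasurable_norm_inner v).pow_const 2).const_mul l).exp.aestronglyMeasurable, ?_⟩
  rw [hasFiniteIntegral_iff_ofReal (ae_of_all _ fun ω => (Real.exp_pos _).le)]
  exact (hb.lintegral_le v hv).trans_lt (by simp)

theorem integral_exp_le (hb : HasSqExpMoment μ b l) {v : Signal 𝕜 d} (hv : ‖v‖ ≤ 4) :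
    ∫ ω, Real.exp (l * ‖inner 𝕜 (b ω) v‖ ^ 2) ∂μ ≤ 2 := by
  have h := hb.lintegral_le v hv
  rw [← ofReal_integral_eq_lintegral_ofReal (hb.integrable_exp hv)
    (ae_of_all _ fun ω => (Real.exp_pos _).le)] at h
  have h2 : (2 : ℝ≥0∞) = ENNReal.ofReal 2 := by simp
  exact (ENNReal.ofReal_le_ofReal_iff (by norm_num)).1 (h.trans h2.le)

theorem pow_le_exp {l y : ℝ} (hl : 0 < l) (hy : 0 ≤ y) (m : ℕ) :
    y ^ m ≤ m.factorial / l ^ m * Real.exp (l * y) := by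
  have h := Real.pow_div_factorial_le_exp (l * y) (by positivity) m
  rw [div_le_iff₀ (by positivity), mul_pow] at h
  rw [div_mul_eq_mul_div, le_div_iff₀ (by positivity)]
  linarith

theorem integrable_pow (hb : HasSqExpMoment μ b l) {v : Signal 𝕜 d} (hv : ‖v‖ ≤ 4) (m : ℕ) :
    Integrable (fun ω => (‖inner 𝕜 (b ω) v‖ ^ 2) ^ m) μ := by
  refine ((hb.integrable_exp hv).const_mul (m.factorial / l ^ m)).mono'
    (((hb.aemeasurable_norm_inner v).pow_const 2).pow_const m).aestronglyMeasurable
    (ae_of_all _ fun ω => ?_)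
  rw [Real.norm_of_nonneg (by positivity)]
  exact pow_le_exp hb.pos (by positivity) m

theorem integral_pow_le (hb : HasSqExpMoment μ b l) {v : Signal 𝕜 d} (hv : ‖v‖ ≤ 4) (m : ℕ) :
    ∫ ω, (‖inner 𝕜 (b ω) v‖ ^ 2) ^ m ∂μ ≤ 2 * m.factorial / l ^ m := by
  have hl := hb.pos
  calc _ ≤ ∫ ω, m.factorial / l ^ m * Real.exp (l * ‖inner 𝕜 (b ω) v‖ ^ 2) ∂μ :=
        integral_mono (hb.integrable_pow hv m) ((hb.integrable_exp hv).const_mul _)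
          fun ω => pow_le_exp hl (by positivity) m
    _ ≤ m.factorial / l ^ m * 2 := by
        rw [integral_const_mul]
        exact mul_le_mul_of_nonneg_left (hb.integral_exp_le hv) (by positivity)
    _ = _ := by ring

theorem norm_pow_four_le (a : Signal 𝕜 d) :
    ‖a‖ ^ 4 ≤ d * ∑ i, (‖inner 𝕜 a (EuclideanSpace.single i (1 : 𝕜))‖ ^ 2) ^ 2 := by
  have h1 : ‖a‖ ^ 4 = (∑ i, ‖a i‖ ^ 2) ^ 2 := by
    rw [← EuclideanSpace.norm_sq_eq, ← pow_mul]
  have h2 : ∀ i, ‖inner 𝕜 a (EuclideanSpace.single i (1 : 𝕜))‖ = ‖a i‖ := fun i => by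
    rw [EuclideanSpace.inner_single_right]; simp
  simp only [h1, h2]
  simpa using sq_sum_le_card_mul_sum_sq (s := Finset.univ) (f := fun i => ‖a i‖ ^ 2)

theorem integrable_norm_pow_four (hb : HasSqExpMoment μ b l) :
    Integrable (fun ω => ‖b ω‖ ^ 4) μ := by
  refine ((integrable_finsetSum Finset.univ fun i _ => hb.integrable_pow (v :=
    EuclideanSpace.single i (1 : 𝕜)) (by simp) 2).const_mul (d : ℝ)).mono'
    (hb.aemeasurable.norm.pow_const 4).aestronglyMeasurable (ae_of_all _ fun ω => ?_)
  rw [Real.norm_of_nonneg (by positivity)]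
  exact norm_pow_four_le _

theorem integral_norm_pow_four_le (hb : HasSqExpMoment μ b l) :
    ∫ ω, ‖b ω‖ ^ 4 ∂μ ≤ 4 * d ^ 2 / l ^ 2 := by
  have hi : ∀ i : Fin d, ‖(EuclideanSpace.single i (1 : 𝕜) : Signal 𝕜 d)‖ ≤ 4 := fun i => by
    simp
  have hint := fun i : Fin d => hb.integrable_pow (hi i) 2
  calc _ ≤ ∫ ω, d * ∑ i, (‖inner 𝕜 (b ω) (EuclideanSpace.single i (1 : 𝕜))‖ ^ 2) ^ 2 ∂μ :=
        integral_mono hb.integrable_norm_pow_four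
          ((integrable_finsetSum _ fun i _ => hint i).const_mul _) fun ω => norm_pow_four_le _
    _ ≤ d * ∑ i : Fin d, 2 * (2 : ℕ).factorial / l ^ 2 := by
        rw [integral_const_mul, integral_finsetSum _ fun i _ => hint i]
        gcongr with i
        exact hb.integral_pow_le (hi i) 2
    _ = _ := by
        simp [Nat.factorial]; ring

theorem integrable_comp [IsFiniteMeasure μ] (hb : HasSqExpMoment μ b l) {F : Type*}
    [NormedAddCommGroup F] [MeasurableSpace F] [BorelSpace F] [SecondCountableTopology F]
    {f : Signal 𝕜 d → F} (hf : Measurable f)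
    {C : ℝ} (hC : ∀ a, ‖f a‖ ≤ C * (1 + ‖a‖ ^ 4)) : Integrable (fun ω => f (b ω)) μ :=
  (((integrable_const (1 : ℝ)).add hb.integrable_norm_pow_four).const_mul C).mono'
    (hf.comp_aemeasurable hb.aemeasurable).aestronglyMeasurable (ae_of_all _ fun _ => hC _)

end HasSqExpMoment

end SubGaussian

/-! ### Continuity in the measurement vector. -/

section Measurability

variable {𝕜 : Type*} [RCLike 𝕜] {d : ℕ}

theorem continuous_bil (h y : Signal 𝕜 d) : Continuous fun a : Signal 𝕜 d => bil a h y := by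
  unfold bil; fun_prop

theorem continuous_norm_inner (y : Signal 𝕜 d) :
    Continuous fun a : Signal 𝕜 d => ‖inner 𝕜 a y‖ := by
  fun_prop

end Measurability

/-! ### Quartic moments computed from the moment conditions. -/

section Moments

variable {𝕜 Ω : Type*} [RCLike 𝕜] [MeasurableSpace Ω] {d : ℕ} {μ : Measure Ω}

theorem integral_sesq {M : Ω → Matrix (Fin d) (Fin d) 𝕜}
    (hM : ∀ m n, Integrable (fun ω => M ω m n) μ) (u v : Fin d → 𝕜) :
    ∫ ω, u ⬝ᵥ (M ω *ᵥ v) ∂μ = u ⬝ᵥ (expMatrix μ M *ᵥ v) := by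
  have h1 : ∀ A : Matrix (Fin d) (Fin d) 𝕜, u ⬝ᵥ (A *ᵥ v) = ∑ m, ∑ n, u m * v n * A m n := by
    intro A
    simp only [dotProduct, Matrix.mulVec, Finset.mul_sum]
    exact Finset.sum_congr rfl fun m _ => Finset.sum_congr rfl fun n _ => by ring
  simp only [h1]
  rw [integral_finsetSum _ fun m _ => integrable_finsetSum _ fun n _ => (hM m n).const_mul _]
  refine Finset.sum_congr rfl fun m _ => ?_
  rw [integral_finsetSum _ fun n _ => (hM m n).const_mul _]
  refine Finset.sum_congr rfl fun n _ => ?_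
  rw [integral_const_mul]
  rfl

theorem star_dotProduct_eq_inner (u v : Signal 𝕜 d) : star u.ofLp ⬝ᵥ v.ofLp = inner 𝕜 u v := by
  simp [dotProduct, PiLp.inner_apply, mul_comm]

theorem star_dotProduct_outer_mulVec (a u v : Signal 𝕜 d) :
    star u.ofLp ⬝ᵥ (outer a *ᵥ v.ofLp) = inner 𝕜 u a * inner 𝕜 a v := by
  rw [outer_mulVec, dotProduct_smul, star_dotProduct_eq_inner, smul_eq_mul, mul_comm]

theorem norm_sq_le_one_add (a : Signal 𝕜 d) : ‖a‖ ^ 2 ≤ 1 + ‖a‖ ^ 4 := by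
  nlinarith [sq_nonneg (‖a‖ ^ 2 - 1)]

theorem norm_outer_le (a : Signal 𝕜 d) (m n : Fin d) : ‖outer a m n‖ ≤ ‖a‖ ^ 2 := by
  simp only [outer, Matrix.of_apply, norm_mul, norm_star]
  rw [sq]
  exact mul_le_mul (PiLp.norm_apply_le a m) (PiLp.norm_apply_le a n) (norm_nonneg _)
    (norm_nonneg _)

theorem continuous_outer (m n : Fin d) : Continuous fun a : Signal 𝕜 d => outer a m n := by
  simp only [outer, Matrix.of_apply]
  fun_prop

variable [IsProbabilityMeasure μ] {b : Ω → Signal 𝕜 d} {l : ℝ}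

/-- The moment conditions for one measurement vector. -/
structure HasMoments (μ : Measure Ω) (b : Ω → Signal 𝕜 d) (τ₁ τ₂ τ₃ τ₄ : ℝ) : Prop where
  second_moment : expMatrix μ (fun ω => outer (b ω)) = (τ₁ : 𝕜) • 1
  fourth_moment : ∀ x : Signal 𝕜 d,
    expMatrix μ (fun ω => quad (outer (b ω)) x • outer (b ω)) =
      ((τ₂ * ‖x‖ ^ 2 : ℝ) : 𝕜) • 1 + (τ₃ : 𝕜) • outer x
        + (τ₄ : 𝕜) • Matrix.diagonal fun i => ((‖x i‖ ^ 2 : ℝ) : 𝕜)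

variable {τ₁ τ₂ τ₃ τ₄ : ℝ}

theorem HasMoments.integral_bil (hb : HasSqExpMoment μ b l)
    (hm : HasMoments μ b τ₁ τ₂ τ₃ τ₄) (u v : Signal 𝕜 d) :
    ∫ ω, bil (b ω) u v ∂μ = τ₁ * RCLike.re (inner 𝕜 u v) := by
  have hi : ∀ m n, Integrable (fun ω => outer (b ω) m n) μ := fun m n =>
    hb.integrable_comp (f := fun a => outer a m n) (continuous_outer m n).measurable (C := 1)
      fun a => by rw [one_mul]; exact (norm_outer_le a m n).trans (norm_sq_le_one_add a)
  have h := integral_sesq hi (star u.ofLp) v.ofLp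
  rw [hm.second_moment, Matrix.smul_mulVec, Matrix.one_mulVec, dotProduct_smul,
    star_dotProduct_eq_inner, smul_eq_mul] at h
  simp only [star_dotProduct_outer_mulVec] at h
  have hint : Integrable (fun ω => inner 𝕜 u (b ω) * inner 𝕜 (b ω) v) μ :=
    hb.integrable_comp (f := fun a => inner 𝕜 u a * inner 𝕜 a v)
      (by fun_prop : Continuous _).measurable (C := ‖u‖ * ‖v‖) fun a => by
        rw [norm_mul]
        calc _ ≤ (‖u‖ * ‖a‖) * (‖a‖ * ‖v‖) := by gcongr <;> exact norm_inner_le_norm _ _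
          _ = ‖u‖ * ‖v‖ * ‖a‖ ^ 2 := by ring
          _ ≤ _ := by gcongr; exact norm_sq_le_one_add a
  simp only [bil]
  rw [show (∫ ω, RCLike.re (inner 𝕜 u (b ω) * inner 𝕜 (b ω) v) ∂μ) = _ from integral_re hint, h,
    RCLike.re_ofReal_mul]

theorem HasMoments.integral_sq (hb : HasSqExpMoment μ b l)
    (hm : HasMoments μ b τ₁ τ₂ τ₃ τ₄) (v : Signal 𝕜 d) :
    ∫ ω, ‖inner 𝕜 (b ω) v‖ ^ 2 ∂μ = τ₁ * ‖v‖ ^ 2 := by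
  simp only [← bil_self]
  rw [hm.integral_bil hb, inner_self_eq_norm_sq]

/-- The form `u* diag(|x_i|²) v`, real part. -/
noncomputable def diagForm (x u v : Signal 𝕜 d) : ℝ :=
  ∑ i, ‖x i‖ ^ 2 * RCLike.re (starRingEnd 𝕜 (u i) * v i)

theorem integrable_mul_bil (hb : HasSqExpMoment μ b l) (x u v : Signal 𝕜 d) :
    Integrable (fun ω => ‖inner 𝕜 (b ω) x‖ ^ 2 * bil (b ω) u v) μ :=
  hb.integrable_comp (f := fun a => ‖inner 𝕜 a x‖ ^ 2 * bil a u v)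
    (((continuous_norm_inner x).pow 2).mul (continuous_bil u v)).measurable
    (C := ‖x‖ ^ 2 * (‖u‖ * ‖v‖)) fun a => by
      rw [norm_mul, Real.norm_of_nonneg (by positivity), Real.norm_eq_abs]
      calc _ ≤ (‖a‖ * ‖x‖) ^ 2 * (‖a‖ ^ 2 * ‖u‖ * ‖v‖) := by
            gcongr
            · exact norm_inner_le_norm _ _
            · exact abs_bil_le_norm _ _ _
        _ = ‖x‖ ^ 2 * (‖u‖ * ‖v‖) * ‖a‖ ^ 4 := by ring
        _ ≤ _ := by gcongr; linarith

theorem integrable_mul_sq (hb : HasSqExpMoment μ b l) (x u : Signal 𝕜 d) :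
    Integrable (fun ω => ‖inner 𝕜 (b ω) x‖ ^ 2 * ‖inner 𝕜 (b ω) u‖ ^ 2) μ := by
  simpa only [bil_self] using integrable_mul_bil hb x u u

theorem integrable_bil_sq (hb : HasSqExpMoment μ b l) (h y : Signal 𝕜 d) :
    Integrable (fun ω => bil (b ω) h y ^ 2) μ :=
  hb.integrable_comp (f := fun a => bil a h y ^ 2) ((continuous_bil h y).pow 2).measurable
    (C := (‖h‖ * ‖y‖) ^ 2) fun a => by
      rw [norm_pow, Real.norm_eq_abs]
      calc _ ≤ (‖a‖ ^ 2 * ‖h‖ * ‖y‖) ^ 2 := by gcongr; exact abs_bil_le_norm _ _ _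
        _ = (‖h‖ * ‖y‖) ^ 2 * ‖a‖ ^ 4 := by ring
        _ ≤ _ := by gcongr; linarith

theorem HasMoments.integral_mul_bil (hb : HasSqExpMoment μ b l)
    (hm : HasMoments μ b τ₁ τ₂ τ₃ τ₄) (x u v : Signal 𝕜 d) :
    ∫ ω, ‖inner 𝕜 (b ω) x‖ ^ 2 * bil (b ω) u v ∂μ =
      τ₂ * ‖x‖ ^ 2 * RCLike.re (inner 𝕜 u v) + τ₃ * bil x u v + τ₄ * diagForm x u v := by
  have hi : ∀ m n, Integrable (fun ω => (quad (outer (b ω)) x • outer (b ω)) m n) μ := fun m n =>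
    hb.integrable_comp (f := fun a => (quad (outer a) x • outer a) m n) (by
      simp only [quad_outer, Matrix.smul_apply, smul_eq_mul]
      exact ((RCLike.continuous_ofReal.comp ((continuous_norm_inner x).pow 2)).mul
        (continuous_outer m n)).measurable) (C := ‖x‖ ^ 2) fun a => by
      simp only [quad_outer, Matrix.smul_apply, smul_eq_mul, norm_mul, RCLike.norm_ofReal, abs_pow,
        abs_norm]
      calc _ ≤ (‖a‖ * ‖x‖) ^ 2 * ‖a‖ ^ 2 := by
            gcongr
            · exact norm_inner_le_norm _ _
            · exact norm_outer_le a m n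
        _ = ‖x‖ ^ 2 * ‖a‖ ^ 4 := by ring
        _ ≤ _ := by gcongr; linarith
  have h := integral_sesq hi (star u.ofLp) v.ofLp
  rw [hm.fourth_moment, Matrix.add_mulVec, Matrix.add_mulVec, Matrix.smul_mulVec,
    Matrix.smul_mulVec, Matrix.smul_mulVec, Matrix.one_mulVec, dotProduct_add, dotProduct_add,
    dotProduct_smul, dotProduct_smul, dotProduct_smul, star_dotProduct_outer_mulVec,
    star_dotProduct_eq_inner] at h
  simp only [quad_outer, Matrix.smul_mulVec, dotProduct_smul, star_dotProduct_outer_mulVec,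
    smul_eq_mul] at h
  have hint : Integrable (fun ω => ((‖inner 𝕜 (b ω) x‖ ^ 2 : ℝ) : 𝕜) *
      (inner 𝕜 u (b ω) * inner 𝕜 (b ω) v)) μ :=
    hb.integrable_comp (f := fun a => ((‖inner 𝕜 a x‖ ^ 2 : ℝ) : 𝕜) *
      (inner 𝕜 u a * inner 𝕜 a v))
      ((RCLike.continuous_ofReal.comp ((continuous_norm_inner x).pow 2)).mul
        (by fun_prop)).measurable (C := ‖x‖ ^ 2 * (‖u‖ * ‖v‖)) fun a => by
        rw [norm_mul, norm_mul, RCLike.norm_ofReal, abs_pow, abs_norm]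
        calc _ ≤ (‖a‖ * ‖x‖) ^ 2 * ((‖u‖ * ‖a‖) * (‖a‖ * ‖v‖)) := by
              gcongr <;> exact norm_inner_le_norm _ _
          _ = ‖x‖ ^ 2 * (‖u‖ * ‖v‖) * ‖a‖ ^ 4 := by ring
          _ ≤ _ := by gcongr; linarith
  have hre : ∀ ω, ‖inner 𝕜 (b ω) x‖ ^ 2 * bil (b ω) u v =
      RCLike.re (((‖inner 𝕜 (b ω) x‖ ^ 2 : ℝ) : 𝕜) * (inner 𝕜 u (b ω) * inner 𝕜 (b ω) v)) :=
    fun ω => by rw [RCLike.re_ofReal_mul, bil]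
  have hdiag : RCLike.re (star u.ofLp ⬝ᵥ
      ((Matrix.diagonal fun i => ((‖x i‖ ^ 2 : ℝ) : 𝕜)) *ᵥ v.ofLp)) = diagForm x u v := by
    simp only [dotProduct, Matrix.mulVec_diagonal, map_sum, diagForm]
    refine Finset.sum_congr rfl fun i _ => ?_
    rw [← RCLike.re_ofReal_mul]
    congr 1
    simp only [Pi.star_apply, RCLike.star_def]
    ring
  simp only [hre]
  rw [show (∫ ω, RCLike.re (((‖inner 𝕜 (b ω) x‖ ^ 2 : ℝ) : 𝕜) *
    (inner 𝕜 u (b ω) * inner 𝕜 (b ω) v)) ∂μ) = _ from integral_re hint, h, map_add, map_add,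
    RCLike.re_ofReal_mul, RCLike.re_ofReal_mul, RCLike.re_ofReal_mul, hdiag, bil]

theorem diagForm_self (x h : Signal 𝕜 d) :
    diagForm x h h = ∑ i, ‖x i‖ ^ 2 * ‖h i‖ ^ 2 := by
  refine Finset.sum_congr rfl fun i _ => ?_
  rw [RCLike.conj_mul, ← RCLike.ofReal_pow, RCLike.ofReal_re]

theorem HasMoments.integral_mul_sq (hb : HasSqExpMoment μ b l)
    (hm : HasMoments μ b τ₁ τ₂ τ₃ τ₄) (x h : Signal 𝕜 d) :
    ∫ ω, ‖inner 𝕜 (b ω) x‖ ^ 2 * ‖inner 𝕜 (b ω) h‖ ^ 2 ∂μ =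
      τ₂ * ‖x‖ ^ 2 * ‖h‖ ^ 2 + τ₃ * ‖inner 𝕜 x h‖ ^ 2 + τ₄ * ∑ i, ‖x i‖ ^ 2 * ‖h i‖ ^ 2 := by
  have := hm.integral_mul_bil hb x h h
  simpa only [bil_self, inner_self_eq_norm_sq, diagForm_self] using this

theorem HasMoments.integral_pow_four (hb : HasSqExpMoment μ b l)
    (hm : HasMoments μ b τ₁ τ₂ τ₃ τ₄) (x : Signal 𝕜 d) :
    ∫ ω, (‖inner 𝕜 (b ω) x‖ ^ 2) ^ 2 ∂μ =
      (τ₂ + τ₃) * (‖x‖ ^ 2) ^ 2 + τ₄ * ∑ i, (‖x i‖ ^ 2) ^ 2 := by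
  have := hm.integral_mul_sq hb x x
  rw [← bil_self, bil, inner_mul_symm_re_eq_norm, norm_mul, inner_self_eq_norm_sq_to_K] at this
  simp only [← sq] at this
  rw [this]
  simp
  ring

/-- The coordinatewise contributions `Re (conj h_i x_i)` to `Re (h* x)`. -/
noncomputable def reCoord (h x : Signal 𝕜 d) (i : Fin d) : ℝ :=
  RCLike.re (starRingEnd 𝕜 (h i) * x i)

theorem sum_reCoord (h x : Signal 𝕜 d) : ∑ i, reCoord h x i = RCLike.re (inner 𝕜 h x) := by
  simp only [reCoord, PiLp.inner_apply, RCLike.inner_apply', map_sum]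

theorem abs_reCoord_le (h x : Signal 𝕜 d) (i : Fin d) : |reCoord h x i| ≤ ‖h i‖ * ‖x i‖ := by
  refine (RCLike.abs_re_le_norm _).trans ?_
  rw [norm_mul, RCLike.norm_conj]

theorem norm_add_apply_sq (h x : Signal 𝕜 d) (i : Fin d) :
    ‖(x + h) i‖ ^ 2 = ‖x i‖ ^ 2 + 2 * reCoord h x i + ‖h i‖ ^ 2 := by
  rw [PiLp.add_apply, add_comm (x i), @norm_add_sq 𝕜 𝕜, RCLike.inner_apply', reCoord]
  ring

theorem norm_sub_apply_sq (h x : Signal 𝕜 d) (i : Fin d) :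
    ‖(x - h) i‖ ^ 2 = ‖x i‖ ^ 2 - 2 * reCoord h x i + ‖h i‖ ^ 2 := by
  rw [PiLp.sub_apply, norm_sub_rev, @norm_sub_sq 𝕜 𝕜, RCLike.inner_apply', reCoord]
  ring

/-- The second moment of `Re (h* a a* x)`, by polarization of the fourth moments. -/
theorem HasMoments.integral_bil_sq (hb : HasSqExpMoment μ b l)
    (hm : HasMoments μ b τ₁ τ₂ τ₃ τ₄) (h x : Signal 𝕜 d) :
    2 * ∫ ω, bil (b ω) h x ^ 2 ∂μ =
      τ₃ * ‖x‖ ^ 2 * ‖h‖ ^ 2 + 2 * (τ₂ + τ₃) * RCLike.re (inner 𝕜 h x) ^ 2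
        - τ₃ * ‖inner 𝕜 h x‖ ^ 2 + 2 * τ₄ * ∑ i, reCoord h x i ^ 2 := by
  have hpt : ∀ ω, 8 * bil (b ω) h x ^ 2 =
      (‖inner 𝕜 (b ω) (x + h)‖ ^ 2) ^ 2 + (‖inner 𝕜 (b ω) (x - h)‖ ^ 2) ^ 2
        - 2 * (‖inner 𝕜 (b ω) x‖ ^ 2) ^ 2 - 2 * (‖inner 𝕜 (b ω) h‖ ^ 2) ^ 2
        - 4 * (‖inner 𝕜 (b ω) x‖ ^ 2 * ‖inner 𝕜 (b ω) h‖ ^ 2) := fun ω => by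
    rw [norm_inner_add_sq, norm_inner_sub_sq]; ring
  have hi : ∀ y, Integrable (fun ω => (‖inner 𝕜 (b ω) y‖ ^ 2) ^ 2) μ := fun y => by
    simpa only [← sq] using integrable_mul_sq hb y y
  have hint := integral_const_mul (μ := μ) 8 (fun ω => bil (b ω) h x ^ 2)
  simp only [hpt] at hint
  have hcomb : ∀ {f₁ f₂ f₃ f₄ f₅ : Ω → ℝ}, Integrable f₁ μ → Integrable f₂ μ → Integrable f₃ μ →
      Integrable f₄ μ → Integrable f₅ μ →
      ∫ ω, (f₁ ω + f₂ ω - 2 * f₃ ω - 2 * f₄ ω - 4 * f₅ ω) ∂μ =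
        ∫ ω, f₁ ω ∂μ + ∫ ω, f₂ ω ∂μ - 2 * ∫ ω, f₃ ω ∂μ - 2 * ∫ ω, f₄ ω ∂μ - 4 * ∫ ω, f₅ ω ∂μ := by
    intro f₁ f₂ f₃ f₄ f₅ h₁ h₂ h₃ h₄ h₅
    have e₁ : Integrable (fun ω => f₁ ω + f₂ ω) μ := h₁.add h₂
    have e₂ : Integrable (fun ω => f₁ ω + f₂ ω - 2 * f₃ ω) μ := e₁.sub (h₃.const_mul 2)
    have e₃ : Integrable (fun ω => f₁ ω + f₂ ω - 2 * f₃ ω - 2 * f₄ ω) μ := e₂.sub (h₄.const_mul 2)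
    rw [integral_sub e₃ (h₅.const_mul 4), integral_sub e₂ (h₄.const_mul 2),
      integral_sub e₁ (h₃.const_mul 2), integral_add h₁ h₂, integral_const_mul,
      integral_const_mul, integral_const_mul]
  rw [hcomb (hi _) (hi _) (hi _) (hi _) (integrable_mul_sq hb x h), hm.integral_pow_four hb,
    hm.integral_pow_four hb, hm.integral_pow_four hb, hm.integral_pow_four hb,
    hm.integral_mul_sq hb] at hint
  have hs : ∑ i, (‖(x + h) i‖ ^ 2) ^ 2 + ∑ i, (‖(x - h) i‖ ^ 2) ^ 2 =
      2 * ∑ i, (‖x i‖ ^ 2) ^ 2 + 2 * ∑ i, (‖h i‖ ^ 2) ^ 2 +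
        4 * ∑ i, ‖x i‖ ^ 2 * ‖h i‖ ^ 2 + 8 * ∑ i, reCoord h x i ^ 2 := by
    simp only [Finset.mul_sum, ← Finset.sum_add_distrib, norm_add_apply_sq, norm_sub_apply_sq]
    exact Finset.sum_congr rfl fun i _ => by ring
  have hn1 : ‖x + h‖ ^ 2 = ‖x‖ ^ 2 + 2 * RCLike.re (inner 𝕜 h x) + ‖h‖ ^ 2 := by
    rw [@norm_add_sq 𝕜, inner_re_symm]
  have hn2 : ‖x - h‖ ^ 2 = ‖x‖ ^ 2 - 2 * RCLike.re (inner 𝕜 h x) + ‖h‖ ^ 2 := by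
    rw [@norm_sub_sq 𝕜, inner_re_symm]
  have hsym : ‖inner 𝕜 x h‖ = ‖inner 𝕜 h x‖ := norm_inner_symm x h
  rw [hn1, hn2, hsym] at hint
  linear_combination -hint / 4 + τ₄ / 4 * hs

theorem HasMoments.integral_bil_mul_sq (hb : HasSqExpMoment μ b l)
    (hm : HasMoments μ b τ₁ τ₂ τ₃ τ₄) (h x : Signal 𝕜 d) :
    ∫ ω, ‖inner 𝕜 (b ω) h‖ ^ 2 * bil (b ω) h x ∂μ =
      (τ₂ + τ₃) * ‖h‖ ^ 2 * RCLike.re (inner 𝕜 h x) +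
        τ₄ * ∑ i, ‖h i‖ ^ 2 * reCoord h x i := by
  rw [hm.integral_mul_bil hb]
  have : bil h h x = ‖h‖ ^ 2 * RCLike.re (inner 𝕜 h x) := by
    rw [bil, inner_self_eq_norm_sq_to_K, ← RCLike.ofReal_pow, RCLike.re_ofReal_mul]
  rw [this]
  simp only [diagForm, reCoord]
  ring

end Moments

/-! ### The radius ε₀. -/

section Radius

variable {τ₂ τ₃ τ₄ : ℝ}

theorem betaConst_le_alphaConst (h₂ : 0 ≤ τ₂) : betaConst τ₃ τ₄ ≤ alphaConst τ₂ τ₃ τ₄ := by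
  unfold betaConst alphaConst; linarith

theorem alphaConst_le_alphaHat : alphaConst τ₂ τ₃ τ₄ ≤ alphaHat τ₂ τ₃ τ₄ := by
  unfold alphaConst alphaHat
  have := le_max_right (-τ₄) 0
  have := abs_nonneg τ₄
  linarith

/-- ε₀ is the positive root of (27/10)αs² + 12|τ₄|s = β. -/
theorem quadratic_le_of_le_epsZero (h₂ : 0 ≤ τ₂) (hβ : 0 < betaConst τ₃ τ₄) {s : ℝ} (hs : 0 ≤ s)
    (hsε : s ≤ epsZero τ₂ τ₃ τ₄) :
    27 / 10 * alphaConst τ₂ τ₃ τ₄ * s ^ 2 + 12 * |τ₄| * s ≤ betaConst τ₃ τ₄ := by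
  have hα : 0 < alphaConst τ₂ τ₃ τ₄ := hβ.trans_le (betaConst_le_alphaConst h₂)
  have ht := abs_nonneg τ₄
  unfold epsZero at hsε
  set α := alphaConst τ₂ τ₃ τ₄
  set β := betaConst τ₃ τ₄
  set t := |τ₄|
  have h1 : 27 * α / 10 * s + 6 * t ≤ √(36 * t ^ 2 + 27 * α * β / 10) := by
    have : 27 * α / 10 * s ≤ 27 * α / 10 * (10 / (27 * α) *
      (√(36 * t ^ 2 + 27 * α * β / 10) - 6 * t)) := by gcongr
    rw [← mul_assoc, show 27 * α / 10 * (10 / (27 * α)) = 1 by field_simp, one_mul] at this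
    linarith
  have h2 := (Real.le_sqrt (by positivity) (by positivity)).1 h1
  have h3 : α * (27 / 10 * α * s ^ 2 + 12 * t * s) ≤ α * β := by nlinarith
  exact le_of_mul_le_mul_left h3 hα

/-- As β ≤ α, the defining quadratic inequality fails for s > 1. The bound is used to keep ‖x +
(3/5)h‖ ≤ 2. -/
theorem le_one_of_le_epsZero (h₂ : 0 ≤ τ₂) (hβ : 0 < betaConst τ₃ τ₄) {s : ℝ} (hs : 0 ≤ s)
    (hsε : s ≤ epsZero τ₂ τ₃ τ₄) : s ≤ 1 := by
  have h1 := quadratic_le_of_le_epsZero h₂ hβ hs hsε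
  have h2 := betaConst_le_alphaConst (τ₃ := τ₃) (τ₄ := τ₄) h₂
  have h3 := mul_nonneg (abs_nonneg τ₄) hs
  by_contra! h4
  have h5 : betaConst τ₃ τ₄ * 1 ≤ alphaConst τ₂ τ₃ τ₄ * s ^ 2 :=
    mul_le_mul h2 (by nlinarith) zero_le_one (hβ.le.trans h2)
  nlinarith

end Radius

/-! ### Expected curvature, expected smoothness and signs of the constants. -/

section Expectation

variable {𝕜 Ω : Type*} [RCLike 𝕜] [MeasurableSpace Ω] {d : ℕ} {μ : Measure Ω}
  [IsProbabilityMeasure μ] {b : Ω → Signal 𝕜 d} {l τ₁ τ₂ τ₃ τ₄ : ℝ}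

theorem sum_abs_reCoord_le (h x : Signal 𝕜 d) : ∑ i, |reCoord h x i| ≤ ‖h‖ * ‖x‖ := by
  refine (Finset.sum_le_sum fun i _ => abs_reCoord_le h x i).trans ?_
  refine (Real.sum_mul_le_sqrt_mul_sqrt _ _ _).trans_eq ?_
  rw [← EuclideanSpace.norm_eq, ← EuclideanSpace.norm_eq]

/-- Apply ∑p² ≤ (∑p)² separately to |c_i| + c_i and |c_i| - c_i, then ∑|c_i| ≤ ‖h‖. Compared with
the trivial bound 2‖h‖², half of the loss is moved to the ρ² term, so a negative τ₄ costs (τ₄)₋ once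
in β. -/
theorem sum_reCoord_sq_le (h x : Signal 𝕜 d) (hx : ‖x‖ = 1) :
    2 * ∑ i, reCoord h x i ^ 2 ≤ ‖h‖ ^ 2 + RCLike.re (inner 𝕜 h x) ^ 2 := by
  have h1 := sum_abs_reCoord_le h x
  rw [hx, mul_one] at h1
  have hp := Finset.sum_sq_le_sq_sum_of_nonneg (s := Finset.univ)
    (f := fun i => |reCoord h x i| + reCoord h x i)
    (fun i _ => by linarith [neg_abs_le (reCoord h x i)])
  have hq := Finset.sum_sq_le_sq_sum_of_nonneg (s := Finset.univ)
    (f := fun i => |reCoord h x i| - reCoord h x i)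
    (fun i _ => by linarith [le_abs_self (reCoord h x i)])
  rw [Finset.sum_add_distrib] at hp
  rw [Finset.sum_sub_distrib] at hq
  rw [sum_reCoord] at hp hq
  have h4 : ∑ i, (|reCoord h x i| + reCoord h x i) ^ 2 +
      ∑ i, (|reCoord h x i| - reCoord h x i) ^ 2 = 4 * ∑ i, reCoord h x i ^ 2 := by
    rw [← Finset.sum_add_distrib, Finset.mul_sum]
    exact Finset.sum_congr rfl fun i _ => by nlinarith [sq_abs (reCoord h x i)]
  have h5 : (∑ i, |reCoord h x i|) ^ 2 ≤ ‖h‖ ^ 2 :=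
    pow_le_pow_left₀ (Finset.sum_nonneg fun i _ => abs_nonneg _) h1 2
  nlinarith

theorem sum_pow_four_le (h : Signal 𝕜 d) : ∑ i, (‖h i‖ ^ 2) ^ 2 ≤ (‖h‖ ^ 2) ^ 2 := by
  rw [EuclideanSpace.norm_sq_eq]
  exact Finset.sum_sq_le_sq_sum_of_nonneg fun i _ => by positivity

theorem sum_mul_reCoord_le (h x : Signal 𝕜 d) (hx : ‖x‖ = 1) :
    |∑ i, ‖h i‖ ^ 2 * reCoord h x i| ≤ ‖h‖ ^ 2 * ‖h‖ := by
  refine (Finset.abs_sum_le_sum_abs _ _).trans ?_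
  have h1 := sum_abs_reCoord_le h x
  rw [hx, mul_one] at h1
  calc _ ≤ ∑ i, ‖h‖ ^ 2 * |reCoord h x i| := by
        refine Finset.sum_le_sum fun i _ => ?_
        rw [abs_mul, abs_of_nonneg (by positivity : 0 ≤ ‖h i‖ ^ 2)]
        gcongr
        exact PiLp.norm_apply_le h i
    _ ≤ _ := by rw [← Finset.mul_sum]; gcongr

/-- The expected curvature of the objective in the neighbourhood of radius `ε₀`. -/
theorem HasMoments.le_integral_curvature (hb : HasSqExpMoment μ b l)
    (hm : HasMoments μ b τ₁ τ₂ τ₃ τ₄) (h₂ : 0 ≤ τ₂) (hβ : 0 < betaConst τ₃ τ₄)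
    {h x : Signal 𝕜 d} (hx : ‖x‖ = 1) (him : RCLike.im (inner 𝕜 h x) = 0)
    (hh : ‖h‖ ≤ epsZero τ₂ τ₃ τ₄) :
    betaConst τ₃ τ₄ / 2 * ‖h‖ ^ 2 ≤
      5 / 2 * ∫ ω, bil (b ω) h (x + (3 / 5 : ℝ) • h) ^ 2 ∂μ - 1 / 2 * ∫ ω, bil (b ω) h x ^ 2 ∂μ := by
  have hexp : ∫ ω, bil (b ω) h (x + (3 / 5 : ℝ) • h) ^ 2 ∂μ =
      ∫ ω, bil (b ω) h x ^ 2 ∂μ + 6 / 5 * ∫ ω, ‖inner 𝕜 (b ω) h‖ ^ 2 * bil (b ω) h x ∂μ +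
        9 / 25 * ∫ ω, (‖inner 𝕜 (b ω) h‖ ^ 2) ^ 2 ∂μ := by
    have i₁ := integrable_bil_sq hb h x
    have i₂ := (integrable_mul_bil hb h h x).const_mul (6 / 5)
    have i₃ : Integrable (fun ω => 9 / 25 * (‖inner 𝕜 (b ω) h‖ ^ 2) ^ 2) μ := by
      simpa only [← sq] using (integrable_mul_sq hb h h).const_mul (9 / 25)
    have i₄ : Integrable (fun ω => bil (b ω) h x ^ 2 +
      6 / 5 * (‖inner 𝕜 (b ω) h‖ ^ 2 * bil (b ω) h x)) μ := i₁.add i₂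
    rw [← integral_const_mul, ← integral_const_mul, ← integral_add i₁ i₂, ← integral_add i₄ i₃]
    congr 1
    funext ω
    rw [bil_add_right, bil_real_smul_right, bil_self]
    ring
  have e₁ := hm.integral_bil_sq hb h x
  have e₂ := hm.integral_bil_mul_sq hb h x
  have e₃ := hm.integral_pow_four hb h
  have hρ : ‖inner 𝕜 h x‖ ^ 2 = RCLike.re (inner 𝕜 h x) ^ 2 := by
    rw [← RCLike.normSq_eq_def', RCLike.normSq_apply, him]; ring
  have hs := sum_reCoord_sq_le h x hx
  have hs0 : 0 ≤ ∑ i, reCoord h x i ^ 2 := Finset.sum_nonneg fun i _ => sq_nonneg _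
  have h4 := sum_pow_four_le h
  have h40 : 0 ≤ ∑ i, (‖h i‖ ^ 2) ^ 2 := Finset.sum_nonneg fun i _ => by positivity
  have h3 := sum_mul_reCoord_le h x hx
  have hρ1 : |RCLike.re (inner 𝕜 h x)| ≤ ‖h‖ := by
    refine (RCLike.abs_re_le_norm _).trans ((norm_inner_le_norm _ _).trans_eq ?_)
    rw [hx, mul_one]
  have hquad := quadratic_le_of_le_epsZero h₂ hβ (norm_nonneg h) hh
  have hα : 0 < alphaConst τ₂ τ₃ τ₄ := hβ.trans_le (betaConst_le_alphaConst h₂)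
  rw [hx, hρ, one_pow, mul_one] at e₁
  rw [hexp, e₂, e₃]
  set ρ := RCLike.re (inner 𝕜 h x)
  set T₂ := ∑ i, reCoord h x i ^ 2
  set T₃ := ∑ i, ‖h i‖ ^ 2 * reCoord h x i
  set T₄ := ∑ i, (‖h i‖ ^ 2) ^ 2
  set s := ‖h‖
  have hs' : 0 ≤ s := norm_nonneg h
  set I := ∫ ω, bil (b ω) h x ^ 2 ∂μ
  unfold alphaConst betaConst at *
  set m := max (-τ₄) 0
  have hm0 : 0 ≤ m := le_max_right _ _
  have hmt : -m ≤ τ₄ := by linarith [le_max_left (-τ₄) 0]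
  have hmabs : m ≤ |τ₄| := max_le (neg_le_abs _) (abs_nonneg _)
  have a₁ : -m * (s ^ 2 + ρ ^ 2) ≤ 2 * τ₄ * T₂ := by
    nlinarith [mul_le_mul_of_nonneg_right hmt hs0, mul_le_mul_of_nonneg_left hs hm0]
  have a₂ : -m * (s ^ 2) ^ 2 ≤ τ₄ * T₄ := by
    nlinarith [mul_le_mul_of_nonneg_right hmt h40, mul_le_mul_of_nonneg_left h4 hm0]
  have a₃ : -(|τ₄| * (s ^ 2 * s)) ≤ τ₄ * T₃ := by
    have : |τ₄ * T₃| ≤ |τ₄| * (s ^ 2 * s) := by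
      rw [abs_mul]; gcongr
    exact (abs_le.1 this).1
  -- The cross term has coefficient τ₂ + τ₃ = α + m; only its α part fits the square in `a₅`, and
  -- the surplus m s²ρ is bounded here.
  have a₄ : -(|τ₄| * (s ^ 2 * s)) ≤ m * s ^ 2 * ρ := by
    have : |m * s ^ 2 * ρ| ≤ |τ₄| * (s ^ 2 * s) := by
      rw [abs_mul, abs_of_nonneg (by positivity), mul_assoc]; gcongr
    exact (abs_le.1 this).1
  -- Completing αρ² + 3αρs² to this square costs (9/4)αs⁴. The fourth moment returns (9/10)αs⁴,
  -- leaving a deficit (27/20)αs⁴, which together with 6|τ₄|s³ is at most (β/2)s² by `hquad`.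
  have a₅ : 0 ≤ (τ₂ + τ₃ - m) * (ρ + 3 / 2 * s ^ 2) ^ 2 := by positivity
  have a₆ := mul_le_mul_of_nonneg_right hquad (sq_nonneg s)
  have a₇ : 0 ≤ τ₂ * ρ ^ 2 := by positivity
  nlinarith

theorem HasMoments.integral_mul_sq_le (hb : HasSqExpMoment μ b l)
    (hm : HasMoments μ b τ₁ τ₂ τ₃ τ₄) (h₃ : 0 ≤ τ₃)
    {x : Signal 𝕜 d} (hx : ‖x‖ = 1) (u : Signal 𝕜 d) :
    ∫ ω, ‖inner 𝕜 (b ω) u‖ ^ 2 * ‖inner 𝕜 (b ω) x‖ ^ 2 ∂μ ≤ alphaHat τ₂ τ₃ τ₄ * ‖u‖ ^ 2 := by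
  rw [hm.integral_mul_sq hb, hx, alphaHat]
  have h1 : ‖inner 𝕜 u x‖ ^ 2 ≤ ‖u‖ ^ 2 := by
    refine pow_le_pow_left₀ (norm_nonneg _) ((norm_inner_le_norm _ _).trans_eq ?_) 2
    rw [hx, mul_one]
  have h2 : ∑ i, ‖u i‖ ^ 2 * ‖x i‖ ^ 2 ≤ ‖u‖ ^ 2 := by
    rw [EuclideanSpace.norm_sq_eq u]
    refine Finset.sum_le_sum fun i _ => mul_le_of_le_one_right (by positivity) ?_
    exact pow_le_one₀ (norm_nonneg _) ((PiLp.norm_apply_le x i).trans hx.le)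
  have h3 : 0 ≤ ∑ i, ‖u i‖ ^ 2 * ‖x i‖ ^ 2 := Finset.sum_nonneg fun i _ => by positivity
  have h4 : τ₄ * ∑ i, ‖u i‖ ^ 2 * ‖x i‖ ^ 2 ≤ |τ₄| * ‖u‖ ^ 2 :=
    mul_le_mul (le_abs_self _) h2 h3 (abs_nonneg _)
  nlinarith [mul_le_mul_of_nonneg_left h1 h₃]

/-- Testing on two different basis vectors removes the τ₃ and τ₄ terms and leaves τ₂ as the mean of
a nonnegative variable. -/
theorem HasMoments.nonneg_of_two_le (hb : HasSqExpMoment μ b l)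
    (hm : HasMoments μ b τ₁ τ₂ τ₃ τ₄) (hd : 2 ≤ d) : 0 ≤ τ₂ := by
  have h := hm.integral_mul_sq hb (EuclideanSpace.single (⟨0, by omega⟩ : Fin d) (1 : 𝕜))
    (EuclideanSpace.single (⟨1, by omega⟩ : Fin d) (1 : 𝕜))
  have hs : ∑ i : Fin d, ‖(EuclideanSpace.single (⟨0, by omega⟩ : Fin d) (1 : 𝕜) : Signal 𝕜 d) i‖ ^ 2
      * ‖(EuclideanSpace.single (⟨1, by omega⟩ : Fin d) (1 : 𝕜) : Signal 𝕜 d) i‖ ^ 2 = 0 := by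
    refine Finset.sum_eq_zero fun i _ => ?_
    by_cases hi : i = ⟨0, by omega⟩
    · subst hi; simp
    · simp [hi]
  rw [hs, EuclideanSpace.inner_single_left] at h
  simp at h
  rw [← h]
  exact integral_nonneg fun ω => by positivity

/-- Under a lower bound on the fourth moments the second moment is bounded below. -/
theorem HasMoments.le_second_moment (hb : HasSqExpMoment μ b l)
    (hm : HasMoments μ b τ₁ τ₂ τ₃ τ₄) {x : Signal 𝕜 d} (hx : ‖x‖ = 1) {δ : ℝ} (hδ : 0 < δ)
    (hα : δ ≤ alphaConst τ₂ τ₃ τ₄) : δ ^ 2 * l ^ 3 / 12 ≤ τ₁ := by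
  have hl := hb.pos
  have hx4 : ‖x‖ ≤ 4 := by rw [hx]; norm_num
  have h4 : δ ≤ ∫ ω, (‖inner 𝕜 (b ω) x‖ ^ 2) ^ 2 ∂μ := by
    rw [hm.integral_pow_four hb, hx]
    have h1 := sum_pow_four_le x
    rw [hx] at h1
    have h0 : 0 ≤ ∑ i, (‖x i‖ ^ 2) ^ 2 := Finset.sum_nonneg fun i _ => by positivity
    unfold alphaConst at hα
    have hm0 : 0 ≤ max (-τ₄) 0 := le_max_right _ _
    have hmt : -max (-τ₄) 0 ≤ τ₄ := by linarith [le_max_left (-τ₄) 0]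
    nlinarith [mul_le_mul_of_nonneg_right hmt h0, mul_le_mul_of_nonneg_left h1 hm0]
  have h6 := hb.integral_pow_le hx4 3
  have h2 := hm.integral_sq hb x
  rw [hx] at h2
  -- Interpolation q² ≤ (s/2)q + q³/(2s), with s chosen so that the cubic part contributes at most
  -- δ/2.
  set s := 12 / (δ * l ^ 3) with hs
  have hs0 : 0 < s := by positivity
  have i₁ : Integrable (fun ω => ‖inner 𝕜 (b ω) x‖ ^ 2) μ := by
    simpa using hb.integrable_pow hx4 1
  have i₃ := hb.integrable_pow hx4 3
  have hle : ∫ ω, (‖inner 𝕜 (b ω) x‖ ^ 2) ^ 2 ∂μ ≤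
      ∫ ω, (s / 2 * ‖inner 𝕜 (b ω) x‖ ^ 2 + s⁻¹ / 2 * (‖inner 𝕜 (b ω) x‖ ^ 2) ^ 3) ∂μ := by
    refine integral_mono (hb.integrable_pow hx4 2) ((i₁.const_mul _).add (i₃.const_mul _))
      fun ω => ?_
    have hq : 0 ≤ ‖inner 𝕜 (b ω) x‖ ^ 2 := by positivity
    have hinv : s * s⁻¹ = 1 := mul_inv_cancel₀ hs0.ne'
    set q := ‖inner 𝕜 (b ω) x‖ ^ 2
    have h7 : 0 ≤ q * s⁻¹ * (s - q) ^ 2 := by positivity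
    have h8 : q * s⁻¹ * (s - q) ^ 2 = q * s - 2 * q ^ 2 + s⁻¹ * q ^ 3 := by
      linear_combination (q * s - 2 * q ^ 2) * hinv
    simp only
    linarith
  rw [integral_add (i₁.const_mul _) (i₃.const_mul _), integral_const_mul, integral_const_mul,
    h2] at hle
  have h9 : s⁻¹ / 2 * (2 * (3 : ℕ).factorial / l ^ 3) = δ / 2 := by
    rw [hs]; simp [Nat.factorial]; field_simp; norm_num
  have h10 : s⁻¹ / 2 * ∫ ω, (‖inner 𝕜 (b ω) x‖ ^ 2) ^ 3 ∂μ ≤ δ / 2 := by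
    rw [← h9]; gcongr
  have h11 : δ ≤ s * τ₁ := by linarith
  have h12 : s * (δ ^ 2 * l ^ 3 / 12) = δ := by rw [hs]; field_simp
  exact le_of_mul_le_mul_left (h12.le.trans h11) hs0

end Expectation

/-! ### Nets of the unit ball. -/

section Net

variable {F : Type*} [NormedAddCommGroup F] [NormedSpace ℝ F] [FiniteDimensional ℝ F]

/-- A 1-separated subset of the ball of radius 2 with the maximal number of points is a 1-net of
that ball; packing bounds its size by 5 to the dimension, and halving it gives the net. -/
theorem exists_half_net : ∃ S : Finset F, S.card ≤ 5 ^ Module.finrank ℝ F ∧ (∀ c ∈ S, ‖c‖ ≤ 1) ∧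
    ∀ θ : F, ‖θ‖ ≤ 1 → ∃ c ∈ S, ‖θ - c‖ ≤ 1 / 2 := by
  classical
  let P : ℕ → Prop := fun n => ∃ s : Finset F, s.card = n ∧ (∀ c ∈ s, ‖c‖ ≤ 2) ∧
    ∀ c ∈ s, ∀ c' ∈ s, c ≠ c' → 1 ≤ ‖c - c'‖
  have hP0 : P 0 := ⟨∅, by simp⟩
  have hPle : ∀ n, P n → n ≤ 5 ^ Module.finrank ℝ F := by
    rintro n ⟨s, rfl, h1, h2⟩
    exact Besicovitch.card_le_of_separated s h1 h2
  obtain ⟨s, hcard, h1, h2⟩ : P (Nat.findGreatest P (5 ^ Module.finrank ℝ F)) :=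
    Nat.findGreatest_spec (Nat.zero_le _) hP0
  refine ⟨s.image fun c => (1 / 2 : ℝ) • c,
    Finset.card_image_le.trans (Besicovitch.card_le_of_separated s h1 h2), ?_, ?_⟩
  · intro c hc
    obtain ⟨c', hc', rfl⟩ := Finset.mem_image.1 hc
    rw [norm_smul]
    norm_num
    linarith [h1 c' hc']
  · intro θ hθ
    suffices h : ∃ c ∈ s, ‖(2 : ℝ) • θ - c‖ ≤ 1 by
      obtain ⟨c, hc, hle⟩ := h
      refine ⟨_, Finset.mem_image_of_mem _ hc, ?_⟩
      have : θ - (1 / 2 : ℝ) • c = (1 / 2 : ℝ) • ((2 : ℝ) • θ - c) := by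
        rw [smul_sub, smul_smul]; norm_num
      rw [this, norm_smul]
      norm_num
      linarith
    by_contra! hfar
    have hnot : (2 : ℝ) • θ ∉ s := fun hmem => by
      have := hfar _ hmem
      rw [sub_self, norm_zero] at this
      linarith
    have hP : P (s.card + 1) := by
      refine ⟨insert ((2 : ℝ) • θ) s, Finset.card_insert_of_notMem hnot, ?_, ?_⟩
      · intro c hc
        rcases Finset.mem_insert.1 hc with rfl | hc
        · rw [norm_smul]; norm_num; linarith
        · exact h1 c hc
      · intro c hc c' hc' hne
        rcases Finset.mem_insert.1 hc with rfl | hc <;> rcases Finset.mem_insert.1 hc' with rfl | hc'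
        · exact absurd rfl hne
        · exact (hfar c' hc').le
        · rw [norm_sub_rev]; exact (hfar c hc).le
        · exact h2 c hc c' hc' hne
    have := Nat.le_findGreatest (hPle _ hP) hP
    omega

/-- Nets of the unit ball at the dyadic scale `2⁻ᵏ`. -/
theorem exists_dyadic_net (k : ℕ) : ∃ S : Finset F, S.card ≤ 5 ^ (k * Module.finrank ℝ F) ∧
    (∀ c ∈ S, ‖c‖ ≤ 2) ∧ ∀ θ : F, ‖θ‖ ≤ 1 → ∃ c ∈ S, ‖θ - c‖ ≤ (1 / 2) ^ k := by
  classical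
  -- The induction carries a sharper radius: rescaled residuals are approximated by the half net,
  -- whose points add at most 2⁻ᵏ, and 2 - 2·2⁻ᵏ + 2⁻ᵏ = 2 - 2·2⁻⁽ᵏ⁺¹⁾.
  suffices h : ∃ S : Finset F, S.card ≤ 5 ^ (k * Module.finrank ℝ F) ∧
      (∀ c ∈ S, ‖c‖ ≤ 2 - 2 * (1 / 2) ^ k) ∧
      ∀ θ : F, ‖θ‖ ≤ 1 → ∃ c ∈ S, ‖θ - c‖ ≤ (1 / 2) ^ k by
    obtain ⟨S, h1, h2, h3⟩ := h
    have : (0 : ℝ) < (1 / 2) ^ k := by positivity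
    exact ⟨S, h1, fun c hc => (h2 c hc).trans (by linarith), h3⟩
  induction k with
  | zero => exact ⟨{0}, by simp⟩
  | succ k ih =>
    obtain ⟨S, h1, h2, h3⟩ := ih
    obtain ⟨S', h1', h2', h3'⟩ := exists_half_net (F := F)
    have hk : (0 : ℝ) < (1 / 2) ^ k := by positivity
    refine ⟨(S ×ˢ S').image fun p => p.1 + ((1 / 2 : ℝ) ^ k) • p.2, ?_, ?_, ?_⟩
    · refine Finset.card_image_le.trans ?_
      rw [Finset.card_product, Nat.succ_mul, pow_add]
      exact Nat.mul_le_mul h1 h1'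
    · intro c hc
      obtain ⟨p, hp, rfl⟩ := Finset.mem_image.1 hc
      obtain ⟨hp1, hp2⟩ := Finset.mem_product.1 hp
      refine (norm_add_le _ _).trans ?_
      rw [norm_smul, Real.norm_of_nonneg hk.le, pow_succ]
      nlinarith [h2 _ hp1, mul_le_mul_of_nonneg_left (h2' _ hp2) hk.le]
    · intro θ hθ
      obtain ⟨c, hc, hle⟩ := h3 θ hθ
      have hinv : ((1 / 2 : ℝ) ^ k) * ((1 / 2 : ℝ) ^ k)⁻¹ = 1 := mul_inv_cancel₀ hk.ne'
      obtain ⟨c', hc', hle'⟩ := h3' (((1 / 2 : ℝ) ^ k)⁻¹ • (θ - c)) (by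
        rw [norm_smul, norm_inv, Real.norm_of_nonneg hk.le]
        exact inv_mul_le_one_of_le₀ hle hk.le)
      refine ⟨_, Finset.mem_image_of_mem _ (Finset.mk_mem_product hc hc'), ?_⟩
      have : θ - (c + ((1 / 2 : ℝ) ^ k) • c') =
          ((1 / 2 : ℝ) ^ k) • (((1 / 2 : ℝ) ^ k)⁻¹ • (θ - c) - c') := by
        rw [smul_sub, smul_smul, hinv, one_smul, sub_sub]
      simp only
      rw [this, norm_smul, Real.norm_of_nonneg hk.le, pow_succ]
      gcongr

end Net

/-! ### A one-sided Chernoff bound. -/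

section Chernoff

/-- Only the positive part of u enters the exponential weight, so a nonpositive variable needs
nothing beyond its second moment. -/
theorem exp_le_quadratic (u : ℝ) : Real.exp u ≤ 1 + u + u ^ 2 * Real.exp (max u 0) := by
  have h1 : 1 ≤ Real.exp (max u 0) := Real.one_le_exp (le_max_right _ _)
  by_cases hu : |u| ≤ 1
  · have h2 := (abs_le.1 (Real.abs_exp_sub_one_sub_id_le hu)).2
    nlinarith [mul_le_mul_of_nonneg_left h1 (sq_nonneg u)]
  · rw [not_le, lt_abs] at hu
    rcases hu with hu | hu
    · rw [max_eq_left (by linarith)]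
      nlinarith [mul_le_mul_of_nonneg_right (one_le_pow₀ hu.le : 1 ≤ u ^ 2) (Real.exp_pos u).le]
    · have h2 : Real.exp u ≤ 1 := Real.exp_le_one_iff.2 (by linarith)
      nlinarith [mul_le_mul_of_nonneg_left h1 (sq_nonneg u)]

variable {Ω E : Type*} [MeasurableSpace Ω] [MeasurableSpace E] {μ : Measure Ω}
  [IsProbabilityMeasure μ] {N : ℕ} {a : Fin N → Ω → E}

/-- The exponential integrability and moment bounds of `f (b)` used in the Chernoff bound. -/
structure ChernoffBound (μ : Measure Ω) (b : Ω → E) (f : E → ℝ) (m V lam : ℝ) : Prop where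
  integrable : Integrable (fun ω => f (b ω)) μ
  integral_le : ∫ ω, f (b ω) ∂μ ≤ m
  integrable_sq_exp : Integrable (fun ω => f (b ω) ^ 2 * Real.exp (lam * max (f (b ω)) 0)) μ
  integral_sq_exp_le : ∫ ω, f (b ω) ^ 2 * Real.exp (lam * max (f (b ω)) 0) ∂μ ≤ V

theorem ChernoffBound.mgf_le {b : Ω → E} {f : E → ℝ} {m V lam : ℝ} (hb : AEMeasurable b μ)
    (hf : Measurable f) (hlam : 0 ≤ lam) (h : ChernoffBound μ b f m V lam) :
    Integrable (fun ω => Real.exp (lam * f (b ω))) μ ∧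
      mgf (fun ω => f (b ω)) μ lam ≤ Real.exp (lam * m + lam ^ 2 * V) := by
  have hpt : ∀ ω, Real.exp (lam * f (b ω)) ≤ 1 + lam * f (b ω) +
      lam ^ 2 * (f (b ω) ^ 2 * Real.exp (lam * max (f (b ω)) 0)) := fun ω => by
    refine (exp_le_quadratic _).trans_eq ?_
    rw [mul_max_of_nonneg _ _ hlam, mul_zero, mul_pow]
    ring
  have i₁ : Integrable (fun ω => 1 + lam * f (b ω)) μ :=
    (integrable_const _).add (h.integrable.const_mul lam)
  have i₂ := h.integrable_sq_exp.const_mul (lam ^ 2)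
  have i₃ : Integrable (fun ω => Real.exp (lam * f (b ω))) μ :=
    (i₁.add i₂).mono' ((hf.comp_aemeasurable hb).const_mul lam).exp.aestronglyMeasurable
      (ae_of_all _ fun ω => by
        rw [Real.norm_of_nonneg (Real.exp_pos _).le]; exact hpt ω)
  refine ⟨i₃, ?_⟩
  calc mgf (fun ω => f (b ω)) μ lam ≤ ∫ ω, (1 + lam * f (b ω) +
        lam ^ 2 * (f (b ω) ^ 2 * Real.exp (lam * max (f (b ω)) 0))) ∂μ :=
        integral_mono i₃ (i₁.add i₂) hpt
    _ = 1 + lam * ∫ ω, f (b ω) ∂μ +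
        lam ^ 2 * ∫ ω, f (b ω) ^ 2 * Real.exp (lam * max (f (b ω)) 0) ∂μ := by
        rw [integral_add i₁ i₂, integral_add (integrable_const _) (h.integrable.const_mul lam),
          integral_const_mul, integral_const_mul]
        simp
    _ ≤ 1 + lam * m + lam ^ 2 * V := by
        gcongr
        · exact h.integral_le
        · exact h.integral_sq_exp_le
    _ ≤ _ := by linarith [Real.add_one_le_exp (lam * m + lam ^ 2 * V)]

/-- The condition lam · V ≤ t/2 lets the second-order term of the moment generating function use up
at most half of the gain lam · t. -/
theorem measure_avg_ge_le (hN : 0 < N) (hind : iIndepFun a μ) (ha : ∀ j, AEMeasurable (a j) μ)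
    {f : E → ℝ} (hf : Measurable f) {m V lam t : ℝ} (hlam : 0 ≤ lam) (hlamV : lam * V ≤ t / 2)
    (h : ∀ j, ChernoffBound μ (a j) f m V lam) :
    μ.real {ω | m + t ≤ avg fun j => f (a j ω)} ≤ Real.exp (-(N * lam * t / 2)) := by
  have hN' : (0 : ℝ) < N := by exact_mod_cast hN
  have hind' : iIndepFun (fun j ω => f (a j ω)) μ := hind.comp (fun _ => f) fun _ => hf
  have hmeas : ∀ j, AEMeasurable (fun ω => f (a j ω)) μ := fun j => hf.comp_aemeasurable (ha j)
  have hset : {ω | m + t ≤ avg fun j => f (a j ω)} =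
      {ω | N * (m + t) ≤ (∑ j, fun ω => f (a j ω)) ω} := by
    ext ω
    simp only [Set.mem_ofPred_eq, avg, Finset.sum_apply]
    rw [inv_mul_eq_div, le_div_iff₀ hN', mul_comm]
  rw [hset]
  have hmgf : mgf (∑ j, fun ω => f (a j ω)) μ lam ≤ Real.exp (N * (lam * m + lam ^ 2 * V)) := by
    rw [hind'.mgf_sum₀ hmeas]
    calc _ ≤ ∏ _j : Fin N, Real.exp (lam * m + lam ^ 2 * V) :=
          Finset.prod_le_prod (fun j _ => mgf_nonneg) fun j _ => ((h j).mgf_le (ha j) hf hlam).2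
      _ = _ := by
          rw [Finset.prod_const, Finset.card_univ, Fintype.card_fin, ← Real.exp_nat_mul]
  -- A non-integrable exponential would have `mgf` equal to the default value 0, whereas the product
  -- of the individual ones is positive.
  have hint : Integrable (fun ω => Real.exp (lam * (∑ j, fun ω => f (a j ω)) ω)) μ := by
    by_contra hcon
    have h0 := mgf_undef hcon
    rw [hind'.mgf_sum₀ hmeas] at h0
    exact (Finset.prod_pos fun j _ => mgf_pos ((h j).mgf_le (ha j) hf hlam).1).ne' h0
  refine (measure_ge_le_exp_mul_mgf _ hlam hint).trans ?_
  calc _ ≤ Real.exp (-lam * (N * (m + t))) * Real.exp (N * (lam * m + lam ^ 2 * V)) := by gcongr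
    _ ≤ _ := by
      rw [← Real.exp_add]
      refine Real.exp_le_exp.2 ?_
      nlinarith [mul_le_mul_of_nonneg_left hlamV (mul_nonneg hN'.le hlam)]

end Chernoff

/-! ### From net points to the whole ball. -/

section Uniform

variable {Ω E F : Type*} [MeasurableSpace Ω] [MeasurableSpace E] [SeminormedAddCommGroup E]
  {μ : Measure Ω} [IsProbabilityMeasure μ] {N : ℕ} {a : Fin N → Ω → E}
  [NormedAddCommGroup F] [NormedSpace ℝ F] [FiniteDimensional ℝ F]

/-- Uniform one-sided deviation of empirical averages over the unit ball of a parameter space. -/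
theorem exists_uniform_avg_le (hN : 0 < N) (hind : iIndepFun a μ)
    (ha : ∀ j, AEMeasurable (a j) μ) {f : F → E → ℝ} (hf : ∀ θ, Measurable (f θ)) {m : F → ℝ}
    {V lam t C C' : ℝ} (hlam : 0 ≤ lam) (hlamV : lam * V ≤ t / 2) (hC : 0 ≤ C) (hC' : 0 ≤ C')
    (h : ∀ θ, ‖θ‖ ≤ 2 → ∀ j, ChernoffBound μ (a j) (f θ) (m θ) V lam)
    (hlip : ∀ θ θ', ‖θ‖ ≤ 2 → ‖θ'‖ ≤ 2 → ∀ e, f θ e - f θ' e ≤ C * (1 + ‖e‖ ^ 4) * ‖θ - θ'‖)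
    (hlip' : ∀ θ θ', ‖θ‖ ≤ 2 → ‖θ'‖ ≤ 2 → m θ - m θ' ≤ C' * ‖θ - θ'‖) (k : ℕ) :
    ∃ B : Set Ω, μ.real B ≤ 5 ^ (k * Module.finrank ℝ F) * Real.exp (-(N * lam * t / 2)) ∧
      ∀ ω ∉ B, ∀ M, (∀ j, ‖a j ω‖ ^ 2 ≤ M) → ∀ θ, ‖θ‖ ≤ 1 →
        avg (fun j => f θ (a j ω)) ≤ m θ + t + (C * (1 + M ^ 2) + C') * (1 / 2) ^ k := by
  obtain ⟨S, hcard, hS, hnet⟩ := exists_dyadic_net (F := F) k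
  refine ⟨⋃ c ∈ S, {ω | m c + t ≤ avg fun j => f c (a j ω)}, ?_, ?_⟩
  · refine (measureReal_biUnion_finset_le _ _).trans ?_
    refine (Finset.sum_le_card_nsmul _ _ _ fun c hc =>
      measure_avg_ge_le hN hind ha (hf c) hlam hlamV (h c (hS c hc))).trans ?_
    rw [nsmul_eq_mul]
    gcongr
    exact_mod_cast hcard
  · intro ω hω M hM θ hθ
    obtain ⟨c, hc, hle⟩ := hnet θ hθ
    have hc2 := hS c hc
    have hθ2 : ‖θ‖ ≤ 2 := by linarith
    have h1 : avg (fun j => f c (a j ω)) < m c + t := by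
      by_contra! hcon
      exact hω (Set.mem_biUnion hc hcon)
    have h2 : avg (fun j => f θ (a j ω) - f c (a j ω)) ≤ C * (1 + M ^ 2) * (1 / 2) ^ k := by
      refine (avg_mono (g := fun _ => C * (1 + M ^ 2) * (1 / 2) ^ k) fun j => ?_).trans
        (avg_const_le (by positivity))
      refine (hlip θ c hθ2 hc2 _).trans ?_
      have : ‖a j ω‖ ^ 4 ≤ M ^ 2 := by
        have := pow_le_pow_left₀ (sq_nonneg _) (hM j) 2
        rwa [← pow_mul] at this
      gcongr
    rw [avg_sub] at h2
    have h3 : m c - m θ ≤ C' * (1 / 2) ^ k := by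
      refine (hlip' c θ hc2 hθ2).trans ?_
      rw [norm_sub_rev]
      gcongr
    linarith

end Uniform

/-! ### Largest norm and largest marginal in the sample. -/

section MaximalNorm

variable {𝕜 Ω : Type*} [RCLike 𝕜] [MeasurableSpace Ω] {d N : ℕ} {μ : Measure Ω}
  [IsProbabilityMeasure μ] {a : Fin N → Ω → Signal 𝕜 d} {l : ℝ}

theorem finrank_signal_le : Module.finrank ℝ (Signal 𝕜 d) ≤ 2 * d := by
  rw [LinearEquiv.finrank_eq (WithLp.linearEquiv 2 ℝ (Fin d → 𝕜)), Module.finrank_pi_fintype]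
  simp only [Finset.sum_const, Finset.card_univ, Fintype.card_fin, smul_eq_mul]
  rw [mul_comm]
  exact Nat.mul_le_mul_right _ (RCLike.finrank_le_two (K := 𝕜))

theorem HasSqExpMoment.tail_le {b : Ω → Signal 𝕜 d} (hb : HasSqExpMoment μ b l)
    {v : Signal 𝕜 d} (hv : ‖v‖ ≤ 4) (s : ℝ) :
    μ.real {ω | s ≤ ‖inner 𝕜 (b ω) v‖ ^ 2} ≤ 2 * Real.exp (-(l * s)) := by
  refine (measure_ge_le_exp_mul_mgf s hb.pos.le (hb.integrable_exp hv)).trans ?_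
  rw [mul_comm, neg_mul]
  gcongr
  exact hb.integral_exp_le hv

theorem measure_exists_inner_ge_le (ha : ∀ j, HasSqExpMoment μ (a j) l) {v : Signal 𝕜 d}
    (hv : ‖v‖ ≤ 4) (s : ℝ) :
    μ.real {ω | ∃ j, s ≤ ‖inner 𝕜 (a j ω) v‖ ^ 2} ≤ N * (2 * Real.exp (-(l * s))) := by
  rw [Set.ofPred_exists]
  refine (measureReal_iUnion_fintype_le _).trans ?_
  refine (Finset.sum_le_sum fun j _ => (ha j).tail_le hv s).trans_eq ?_
  simp

/-- A point of the half net near a/‖a‖ sees at least half of ‖a‖, hence a quarter of ‖a‖²; a union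
bound over the net and the sample finishes. -/
theorem measure_exists_norm_gt_le (ha : ∀ j, HasSqExpMoment μ (a j) l) (s : ℝ) :
    μ.real {ω | ∃ j, s < ‖a j ω‖ ^ 2} ≤
      5 ^ (2 * d) * (N * (2 * Real.exp (-(l * (s / 4))))) := by
  obtain ⟨S, hcard, hS, hnet⟩ := exists_half_net (F := Signal 𝕜 d)
  have hsub : {ω | ∃ j, s < ‖a j ω‖ ^ 2} ⊆
      ⋃ c ∈ S, {ω | ∃ j, s / 4 ≤ ‖inner 𝕜 (a j ω) c‖ ^ 2} := by
    rintro ω ⟨j, hj⟩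
    have key : ∃ c ∈ S, ‖a j ω‖ / 2 ≤ ‖inner 𝕜 (a j ω) c‖ := by
      set e := a j ω
      by_cases he : e = 0
      · obtain ⟨c, hc, -⟩ := hnet 0 (by simp)
        exact ⟨c, hc, by simp [he]⟩
      · have hn : ‖e‖ ≠ 0 := by simpa using he
        set v : Signal 𝕜 d := ((‖e‖⁻¹ : ℝ) : 𝕜) • e with hv
        obtain ⟨c, hc, hle⟩ := hnet v (by
          rw [hv, norm_smul, RCLike.norm_ofReal, abs_inv, abs_norm, inv_mul_cancel₀ hn])
        refine ⟨c, hc, ?_⟩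
        have h1 : ‖inner 𝕜 e v‖ = ‖e‖ := by
          rw [hv, inner_smul_right, inner_self_eq_norm_sq_to_K, norm_mul, RCLike.norm_ofReal,
            abs_inv, abs_norm, norm_pow, RCLike.norm_ofReal, abs_norm]
          field_simp
        have h2 : ‖inner 𝕜 e (v - c)‖ ≤ ‖e‖ * (1 / 2) :=
          (norm_inner_le_norm _ _).trans (by gcongr)
        rw [inner_sub_right] at h2
        have h3 := norm_sub_norm_le (inner 𝕜 e v) (inner 𝕜 e c)
        linarith
    obtain ⟨c, hc, hle⟩ := key
    refine Set.mem_biUnion hc ⟨j, ?_⟩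
    nlinarith [norm_nonneg (a j ω)]
  refine (measureReal_mono hsub (measure_ne_top _ _)).trans
    ((measureReal_biUnion_finset_le _ _).trans ?_)
  refine (Finset.sum_le_card_nsmul _ _ _ fun c hc =>
    measure_exists_inner_ge_le ha ((hS c hc).trans (by norm_num)) _).trans ?_
  rw [nsmul_eq_mul]
  gcongr
  have : S.card ≤ 5 ^ (2 * d) :=
    hcard.trans (Nat.pow_le_pow_right (by norm_num) finrank_signal_le)
  exact_mod_cast this

end MaximalNorm

/-! ### Uniform deviation bounds for the three families of averages. -/

section Families

variable {𝕜 Ω : Type*} [RCLike 𝕜] [MeasurableSpace Ω] {d N : ℕ} {μ : Measure Ω}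

theorem ChernoffBound.of_le {E : Type*} [MeasurableSpace E] {b : Ω → E} {f : E → ℝ}
    {g : Ω → ℝ} {m V lam : ℝ} (hb : AEMeasurable b μ) (hf : Measurable f)
    (hint : Integrable (fun ω => f (b ω)) μ) (hm : ∫ ω, f (b ω) ∂μ ≤ m)
    (hg : Integrable g μ) (hgV : ∫ ω, g ω ∂μ ≤ V)
    (hle : ∀ ω, f (b ω) ^ 2 * Real.exp (lam * max (f (b ω)) 0) ≤ g ω) :
    ChernoffBound μ b f m V lam := by
  have hi : Integrable (fun ω => f (b ω) ^ 2 * Real.exp (lam * max (f (b ω)) 0)) μ := by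
    refine hg.mono' ?_ (ae_of_all _ fun ω => ?_)
    · have h1 := hf.comp_aemeasurable hb
      exact ((h1.pow_const 2).mul
        (((h1.max aemeasurable_const).const_mul lam).exp)).aestronglyMeasurable
    · rw [Real.norm_of_nonneg (by positivity)]
      exact hle ω
  exact ⟨hint, hm, hi, (integral_mono hi hg hle).trans hgV⟩

/-- The variance proxy of the deviation bounds. -/
noncomputable def varBound (l : ℝ) : ℝ := 500 / l ^ 4 + 16 / l ^ 2

variable {b : Ω → Signal 𝕜 d} {l T lam : ℝ}

theorem chernoffBound_sq (hb : HasSqExpMoment μ b l) (hT : lam ≤ l / 4)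
    {h : Signal 𝕜 d} (hh : ‖h‖ ≤ 4) :
    ChernoffBound μ b (fun a => ‖inner 𝕜 a h‖ ^ 2) (∫ ω, ‖inner 𝕜 (b ω) h‖ ^ 2 ∂μ)
      (varBound l) lam := by
  have hl := hb.pos
  refine ChernoffBound.of_le hb.aemeasurable ((continuous_norm_inner h).pow 2).measurable
    (by simpa using hb.integrable_pow hh 1) le_rfl
    ((hb.integrable_exp hh).const_mul (8 / l ^ 2)) ?_ fun ω => ?_
  · rw [integral_const_mul]
    calc _ ≤ 8 / l ^ 2 * 2 := by gcongr; exact hb.integral_exp_le hh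
      _ = 16 / l ^ 2 := by ring
      _ ≤ varBound l := by
          unfold varBound
          have : 0 ≤ 500 / l ^ 4 := by positivity
          linarith
  · rw [max_eq_left (by positivity)]
    set q := ‖inner 𝕜 (b ω) h‖ ^ 2
    have hq : 0 ≤ q := by positivity
    have h1 := HasSqExpMoment.pow_le_exp (half_pos hl) hq 2
    have hf : ((2 : ℕ).factorial : ℝ) / (l / 2) ^ 2 = 8 / l ^ 2 := by
      simp [Nat.factorial]; field_simp; norm_num
    rw [hf] at h1
    calc _ ≤ 8 / l ^ 2 * Real.exp (l / 2 * q) * Real.exp (l / 2 * q) := by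
          gcongr
          linarith
      _ = _ := by
          rw [mul_assoc, ← Real.exp_add]; congr 2; ring

variable [IsProbabilityMeasure μ]

theorem pow_four_mul_exp_le {l q : ℝ} (hl : 0 < l) (hq : 0 ≤ q) :
    q ^ 4 * Real.exp (l / 2 * q) ≤ 384 / l ^ 4 * Real.exp (l * q) := by
  have h := HasSqExpMoment.pow_le_exp (half_pos hl) hq 4
  have he : Real.exp (l * q) = Real.exp (l / 2 * q) * Real.exp (l / 2 * q) := by
    rw [← Real.exp_add]; congr 1; ring
  have hf : ((4 : ℕ).factorial : ℝ) / (l / 2) ^ 4 = 384 / l ^ 4 := by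
    simp [Nat.factorial]; field_simp; norm_num
  rw [hf] at h
  rw [he, ← mul_assoc]
  gcongr

theorem bil_sq_le_mul (a h y : Signal 𝕜 d) :
    bil a h y ^ 2 ≤ ‖inner 𝕜 a h‖ ^ 2 * ‖inner 𝕜 a y‖ ^ 2 := by
  rw [← bil_sq_add_bil_I_sq]
  exact le_add_of_nonneg_right (sq_nonneg _)

/-- The truncated square `Re (h* a a* x)²`, cut off where `|a* x|² > T`. -/
noncomputable def truncBil (T : ℝ) (x h a : Signal 𝕜 d) : ℝ :=
  if ‖inner 𝕜 a x‖ ^ 2 ≤ T then bil a h x ^ 2 else 0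

theorem measurable_truncBil (x h : Signal 𝕜 d) : Measurable (truncBil T x h) :=
  Measurable.ite (measurableSet_le ((continuous_norm_inner x).pow 2).measurable measurable_const)
    ((continuous_bil h x).pow 2).measurable measurable_const

theorem truncBil_nonneg (x h a : Signal 𝕜 d) : 0 ≤ truncBil T x h a := by
  unfold truncBil; split_ifs <;> positivity

theorem truncBil_le (x h a : Signal 𝕜 d) : truncBil T x h a ≤ bil a h x ^ 2 := by
  unfold truncBil
  split_ifs
  · exact le_rfl
  · positivity

/-- Write p = |a*x|² and q = |a*h|². Where p ≤ T the truncated square is at most Tq, so the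
exponential weight is at most exp(lq/4). The arithmetic-geometric mean inequality separates p from
q, and exp(lq) absorbs the remaining powers of q. -/
theorem truncBil_sq_mul_exp_le (hl : 0 < l) (hlam : 0 ≤ lam) (hT : lam * T ≤ l / 4)
    (x h a : Signal 𝕜 d) :
    truncBil T x h a ^ 2 * Real.exp (lam * max (truncBil T x h a) 0) ≤
      1 / 2 * (‖inner 𝕜 a x‖ ^ 2) ^ 4 +
        192 / l ^ 4 * Real.exp (l * ‖inner 𝕜 a h‖ ^ 2) := by
  rw [max_eq_left (truncBil_nonneg x h a)]
  have hle : truncBil T x h a ≤ ‖inner 𝕜 a h‖ ^ 2 * ‖inner 𝕜 a x‖ ^ 2 :=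
    (truncBil_le x h a).trans (bil_sq_le_mul a h x)
  have hT' : lam * truncBil T x h a ≤ l / 4 * ‖inner 𝕜 a h‖ ^ 2 := by
    by_cases hp : ‖inner 𝕜 a x‖ ^ 2 ≤ T
    · calc lam * truncBil T x h a ≤ lam * (‖inner 𝕜 a h‖ ^ 2 * T) := by
            gcongr; exact hle.trans (by gcongr)
        _ = lam * T * ‖inner 𝕜 a h‖ ^ 2 := by ring
        _ ≤ _ := by gcongr
    · rw [truncBil, if_neg hp, mul_zero]; positivity
  have h0 := truncBil_nonneg (T := T) x h a
  have h4 := pow_four_mul_exp_le hl (sq_nonneg ‖inner 𝕜 a h‖)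
  set p := ‖inner 𝕜 a x‖ ^ 2
  set q := ‖inner 𝕜 a h‖ ^ 2
  have he : Real.exp (l / 2 * q) = Real.exp (l / 4 * q) ^ 2 := by
    rw [← Real.exp_nat_mul]; congr 1; push_cast; ring
  calc _ ≤ (q * p) ^ 2 * Real.exp (l / 4 * q) := by gcongr
    _ ≤ 1 / 2 * p ^ 4 + 1 / 2 * (q ^ 4 * Real.exp (l / 2 * q)) := by
        rw [he]; nlinarith [sq_nonneg (p ^ 2 - q ^ 2 * Real.exp (l / 4 * q))]
    _ ≤ 1 / 2 * p ^ 4 + 1 / 2 * (384 / l ^ 4 * Real.exp (l * q)) := by gcongr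
    _ = _ := by ring

theorem chernoffBound_truncBil (hb : HasSqExpMoment μ b l) (hlam : 0 ≤ lam) (hT : lam * T ≤ l / 4)
    {x h : Signal 𝕜 d} (hx : ‖x‖ ≤ 4) (hh : ‖h‖ ≤ 4) :
    ChernoffBound μ b (truncBil T x h) (∫ ω, bil (b ω) h x ^ 2 ∂μ) (varBound l) lam := by
  have hl := hb.pos
  have hmeas := measurable_truncBil (T := T) x h
  have hint : Integrable (fun ω => truncBil T x h (b ω)) μ :=
    (integrable_bil_sq hb h x).mono' (hmeas.comp_aemeasurable hb.aemeasurable).aestronglyMeasurable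
      (ae_of_all _ fun ω => by
        rw [Real.norm_of_nonneg (truncBil_nonneg _ _ _)]; exact truncBil_le _ _ _)
  refine ChernoffBound.of_le hb.aemeasurable hmeas hint
    (integral_mono hint (integrable_bil_sq hb h x) fun ω => truncBil_le _ _ _)
    (((hb.integrable_pow hx 4).const_mul (1 / 2)).add ((hb.integrable_exp hh).const_mul (192 / l ^ 4)))
    ?_ fun ω => truncBil_sq_mul_exp_le hl hlam hT x h _
  simp only [Pi.add_apply]
  rw [integral_add ((hb.integrable_pow hx 4).const_mul _) ((hb.integrable_exp hh).const_mul _),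
    integral_const_mul, integral_const_mul]
  calc _ ≤ 1 / 2 * (2 * (4 : ℕ).factorial / l ^ 4) + 192 / l ^ 4 * 2 := by
        gcongr
        · exact hb.integral_pow_le hx 4
        · exact hb.integral_exp_le hh
    _ = 408 / l ^ 4 := by simp [Nat.factorial]; ring
    _ ≤ varBound l := by
        unfold varBound
        have : 0 ≤ 16 / l ^ 2 := by positivity
        have : 408 / l ^ 4 ≤ 500 / l ^ 4 := by gcongr; norm_num
        linarith

/-- The variable is nonpositive, so its exponential weight is 1 for every lam and no truncation is
needed. -/
theorem chernoffBound_neg_bil (hb : HasSqExpMoment μ b l)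
    {h y : Signal 𝕜 d} (hh : ‖h‖ ≤ 4) (hy : ‖y‖ ≤ 4) :
    ChernoffBound μ b (fun a => -bil a h y ^ 2) (-∫ ω, bil (b ω) h y ^ 2 ∂μ) (varBound l) lam := by
  have hl := hb.pos
  refine ChernoffBound.of_le hb.aemeasurable ((continuous_bil h y).pow 2).neg.measurable
    (integrable_bil_sq hb h y).neg (integral_neg _).le
    (((hb.integrable_pow hh 4).const_mul (1 / 2)).add ((hb.integrable_pow hy 4).const_mul (1 / 2)))
    ?_ fun ω => ?_
  · simp only [Pi.add_apply]
    rw [integral_add ((hb.integrable_pow hh 4).const_mul _) ((hb.integrable_pow hy 4).const_mul _),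
      integral_const_mul, integral_const_mul]
    calc _ ≤ 1 / 2 * (2 * (4 : ℕ).factorial / l ^ 4) + 1 / 2 * (2 * (4 : ℕ).factorial / l ^ 4) := by
          gcongr
          · exact hb.integral_pow_le hh 4
          · exact hb.integral_pow_le hy 4
      _ = 48 / l ^ 4 := by simp [Nat.factorial]; ring
      _ ≤ varBound l := by
          unfold varBound
          have : 0 ≤ 16 / l ^ 2 := by positivity
          have : 48 / l ^ 4 ≤ 500 / l ^ 4 := by gcongr; norm_num
          linarith
  · have h1 := bil_sq_le_mul (b ω) h y
    rw [max_eq_right (neg_nonpos.2 (sq_nonneg _)), mul_zero, Real.exp_zero, mul_one, neg_sq]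
    simp only [Pi.add_apply]
    set p := ‖inner 𝕜 (b ω) h‖ ^ 2
    set q := ‖inner 𝕜 (b ω) y‖ ^ 2
    calc (bil (b ω) h y ^ 2) ^ 2 ≤ (p * q) ^ 2 := by gcongr
      _ ≤ _ := by nlinarith [sq_nonneg (p ^ 2 - q ^ 2)]

theorem bil_sq_sub_le (a h h' y y' : Signal 𝕜 d) {r : ℝ} (hh : ‖h‖ ≤ 2) (hh' : ‖h'‖ ≤ 2)
    (hy : ‖y‖ ≤ 4) (hy' : ‖y'‖ ≤ 4) (hr : ‖h - h'‖ ≤ r) (hr' : ‖y - y'‖ ≤ 2 * r) :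
    bil a h y ^ 2 - bil a h' y' ^ 2 ≤ 128 * ‖a‖ ^ 4 * r := by
  have h1 : bil a h y - bil a h' y' = bil a (h - h') y + bil a h' (y - y') := by
    rw [bil_sub_left, bil_sub_right]; ring
  have h2 : |bil a h y - bil a h' y'| ≤ 8 * ‖a‖ ^ 2 * r := by
    rw [h1]
    refine (abs_add_le _ _).trans ?_
    calc _ ≤ ‖a‖ ^ 2 * ‖h - h'‖ * ‖y‖ + ‖a‖ ^ 2 * ‖h'‖ * ‖y - y'‖ :=
          add_le_add (abs_bil_le_norm _ _ _) (abs_bil_le_norm _ _ _)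
      _ ≤ ‖a‖ ^ 2 * r * 4 + ‖a‖ ^ 2 * 2 * (2 * r) := by
          have : 0 ≤ r := (norm_nonneg _).trans hr
          gcongr
      _ = _ := by ring
  have h3 : |bil a h y + bil a h' y'| ≤ 16 * ‖a‖ ^ 2 := by
    refine (abs_add_le _ _).trans ?_
    calc _ ≤ ‖a‖ ^ 2 * ‖h‖ * ‖y‖ + ‖a‖ ^ 2 * ‖h'‖ * ‖y'‖ :=
          add_le_add (abs_bil_le_norm _ _ _) (abs_bil_le_norm _ _ _)
      _ ≤ ‖a‖ ^ 2 * 2 * 4 + ‖a‖ ^ 2 * 2 * 4 := by gcongr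
      _ = _ := by ring
  calc bil a h y ^ 2 - bil a h' y' ^ 2
      = (bil a h y - bil a h' y') * (bil a h y + bil a h' y') := by ring
    _ ≤ |bil a h y - bil a h' y'| * |bil a h y + bil a h' y'| := by
        rw [← abs_mul]; exact le_abs_self _
    _ ≤ (8 * ‖a‖ ^ 2 * r) * (16 * ‖a‖ ^ 2) :=
        mul_le_mul h2 h3 (abs_nonneg _) ((abs_nonneg _).trans h2)
    _ = _ := by ring

theorem integral_bil_sq_sub_le (hb : HasSqExpMoment μ b l) (h h' y y' : Signal 𝕜 d) {r : ℝ}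
    (hh : ‖h‖ ≤ 2) (hh' : ‖h'‖ ≤ 2) (hy : ‖y‖ ≤ 4) (hy' : ‖y'‖ ≤ 4)
    (hr : ‖h - h'‖ ≤ r) (hr' : ‖y - y'‖ ≤ 2 * r) :
    ∫ ω, bil (b ω) h y ^ 2 ∂μ - ∫ ω, bil (b ω) h' y' ^ 2 ∂μ ≤
      128 * (1 + 4 * d ^ 2 / l ^ 2) * r := by
  have hr0 : 0 ≤ r := (norm_nonneg _).trans hr
  have i₁ := integrable_bil_sq hb h y
  have i₂ := integrable_bil_sq hb h' y'
  rw [← integral_sub i₁ i₂]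
  calc _ ≤ ∫ ω, 128 * r * ‖b ω‖ ^ 4 ∂μ :=
        integral_mono (i₁.sub i₂) (hb.integrable_norm_pow_four.const_mul _) fun ω => by
          have := bil_sq_sub_le (b ω) h h' y y' hh hh' hy hy' hr hr'
          simp only [Pi.sub_apply]
          linarith
    _ ≤ 128 * r * (4 * d ^ 2 / l ^ 2) := by
        rw [integral_const_mul]; gcongr; exact hb.integral_norm_pow_four_le
    _ ≤ _ := by nlinarith

theorem norm_inner_sq_sub_le (a h h' : Signal 𝕜 d) (hh : ‖h‖ ≤ 2) (hh' : ‖h'‖ ≤ 2) :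
    ‖inner 𝕜 a h‖ ^ 2 - ‖inner 𝕜 a h'‖ ^ 2 ≤ 128 * (1 + ‖a‖ ^ 4) * ‖h - h'‖ := by
  have h1 : ‖inner 𝕜 a h‖ - ‖inner 𝕜 a h'‖ ≤ ‖a‖ * ‖h - h'‖ := by
    refine (norm_sub_norm_le _ _).trans ?_
    rw [← inner_sub_right]
    exact norm_inner_le_norm _ _
  have h2 : ‖inner 𝕜 a h‖ + ‖inner 𝕜 a h'‖ ≤ ‖a‖ * 4 := by
    have e₁ : ‖inner 𝕜 a h‖ ≤ ‖a‖ * 2 := (norm_inner_le_norm _ _).trans (by gcongr)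
    have e₂ : ‖inner 𝕜 a h'‖ ≤ ‖a‖ * 2 := (norm_inner_le_norm _ _).trans (by gcongr)
    linarith
  calc ‖inner 𝕜 a h‖ ^ 2 - ‖inner 𝕜 a h'‖ ^ 2
      = (‖inner 𝕜 a h‖ - ‖inner 𝕜 a h'‖) * (‖inner 𝕜 a h‖ + ‖inner 𝕜 a h'‖) := by ring
    _ ≤ (‖a‖ * ‖h - h'‖) * (‖inner 𝕜 a h‖ + ‖inner 𝕜 a h'‖) := by gcongr
    _ ≤ (‖a‖ * ‖h - h'‖) * (‖a‖ * 4) := by gcongr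
    _ = 4 * ‖a‖ ^ 2 * ‖h - h'‖ := by ring
    _ ≤ 4 * (1 + ‖a‖ ^ 4) * ‖h - h'‖ := by gcongr; exact norm_sq_le_one_add a
    _ ≤ _ := by gcongr; norm_num

theorem integral_norm_inner_sq_sub_le (hb : HasSqExpMoment μ b l) (h h' : Signal 𝕜 d)
    (hh : ‖h‖ ≤ 2) (hh' : ‖h'‖ ≤ 2) :
    ∫ ω, ‖inner 𝕜 (b ω) h‖ ^ 2 ∂μ - ∫ ω, ‖inner 𝕜 (b ω) h'‖ ^ 2 ∂μ ≤
      128 * (1 + 4 * d ^ 2 / l ^ 2) * ‖h - h'‖ := by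
  have i₁ : Integrable (fun ω => ‖inner 𝕜 (b ω) h‖ ^ 2) μ := by
    simpa using hb.integrable_pow (v := h) (hh.trans (by norm_num)) 1
  have i₂ : Integrable (fun ω => ‖inner 𝕜 (b ω) h'‖ ^ 2) μ := by
    simpa using hb.integrable_pow (v := h') (hh'.trans (by norm_num)) 1
  have i₃ : Integrable (fun ω => 1 + ‖b ω‖ ^ 4) μ :=
    (integrable_const 1).add hb.integrable_norm_pow_four
  rw [← integral_sub i₁ i₂]
  calc _ ≤ ∫ ω, 128 * (1 + ‖b ω‖ ^ 4) * ‖h - h'‖ ∂μ :=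
        integral_mono (i₁.sub i₂) ((i₃.const_mul 128).mul_const _) fun ω => by
          simp only [Pi.sub_apply]
          exact norm_inner_sq_sub_le _ h h' hh hh'
    _ ≤ _ := by
        rw [integral_mul_const, integral_const_mul,
          integral_add (integrable_const 1) hb.integrable_norm_pow_four]
        simp only [integral_const, probReal_univ, smul_eq_mul, one_mul]
        gcongr
        exact hb.integral_norm_pow_four_le

theorem exists_eq_norm_smul (h : Signal 𝕜 d) :
    ∃ v : Signal 𝕜 d, ‖v‖ ≤ 1 ∧ h = ‖h‖ • v := by
  by_cases hh : h = 0
  · exact ⟨0, by simp, by simp [hh]⟩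
  · have hn : ‖h‖ ≠ 0 := by simpa using hh
    refine ⟨‖h‖⁻¹ • h, ?_, ?_⟩
    · rw [norm_smul, norm_inv, norm_norm, inv_mul_cancel₀ hn]
    · rw [smul_smul, mul_inv_cancel₀ hn, one_smul]

variable {a : Fin N → Ω → Signal 𝕜 d} {G : Signal 𝕜 d → Signal 𝕜 d → ℝ}

/-- The discretization error of the nets. -/
noncomputable def netError (d : ℕ) (l M : ℝ) (k : ℕ) : ℝ :=
  (128 * (1 + M ^ 2) + 128 * (1 + 4 * d ^ 2 / l ^ 2)) * (1 / 2) ^ k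

theorem card_mul_exp_le {n m : ℕ} (h : n ≤ m) (k : ℕ) (c : ℝ) :
    (5 : ℝ) ^ (k * n) * Real.exp c ≤ 5 ^ (k * m) * Real.exp c := by
  gcongr
  norm_num

/-- The cut depends on the fixed x alone, so the truncated square is still Lipschitz in h.
Truncation can only lower the mean, which is harmless for an upper bound, and it is inactive when
every |a_j* x|² ≤ T. Homogeneity in h passes from the unit ball to all h. -/
theorem exists_forall_avg_bil_sq_le (hN : 0 < N) (hind : iIndepFun a μ)
    (ha : ∀ j, HasSqExpMoment μ (a j) l) (hG : ∀ j h y, ∫ ω, bil (a j ω) h y ^ 2 ∂μ = G h y)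
    {x : Signal 𝕜 d} (hx : ‖x‖ = 1) {t : ℝ} (hlam : 0 ≤ lam) (hT : lam * T ≤ l / 4)
    (hlamV : lam * varBound l ≤ t / 2) (k : ℕ) :
    ∃ B : Set Ω, μ.real B ≤ 5 ^ (k * (4 * d)) * Real.exp (-(N * lam * t / 2)) ∧
      ∀ ω ∉ B, ∀ M, (∀ j, ‖a j ω‖ ^ 2 ≤ M) → (∀ j, ‖inner 𝕜 (a j ω) x‖ ^ 2 ≤ T) → ∀ h,
        avg (fun j => bil (a j ω) h x ^ 2) ≤ G h x + (t + netError d l M k) * ‖h‖ ^ 2 := by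
  have hx4 : ‖x‖ ≤ 4 := by rw [hx]; norm_num
  have hl := (ha ⟨0, hN⟩).pos
  obtain ⟨B, hB, hgood⟩ := exists_uniform_avg_le (F := Signal 𝕜 d) hN hind
    (fun j => (ha j).aemeasurable) (f := fun h => truncBil T x h)
    (fun h => measurable_truncBil x h) (m := fun h => G h x) (C := 128)
    (C' := 128 * (1 + 4 * d ^ 2 / l ^ 2)) hlam hlamV (by norm_num) (by positivity)
    (fun h hh j => by
      rw [← hG j]
      exact chernoffBound_truncBil (ha j) hlam hT hx4 (hh.trans (by norm_num)))
    (fun h h' hh hh' e => by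
      have h1 := bil_sq_sub_le e h h' x x hh hh' hx4 hx4 le_rfl (by simp)
      have h2 : 0 ≤ 128 * ‖h - h'‖ := by positivity
      unfold truncBil
      split_ifs
      · nlinarith
      · rw [sub_zero]; positivity)
    (fun h h' hh hh' => by
      rw [← hG ⟨0, hN⟩, ← hG ⟨0, hN⟩]
      exact integral_bil_sq_sub_le (ha _) h h' x x hh hh' hx4 hx4 le_rfl (by simp)) k
  refine ⟨B, hB.trans (card_mul_exp_le (finrank_signal_le.trans (by omega)) _ _), ?_⟩
  intro ω hω M hM hTω h
  obtain ⟨v, hv, hhv⟩ := exists_eq_norm_smul h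
  have h1 := hgood ω hω M hM v hv
  have h2 : ∀ j, truncBil T x v (a j ω) = bil (a j ω) v x ^ 2 := fun j => if_pos (hTω j)
  simp only [h2] at h1
  have h3 : avg (fun j => bil (a j ω) h x ^ 2) = ‖h‖ ^ 2 * avg fun j => bil (a j ω) v x ^ 2 := by
    rw [← avg_const_mul]
    congr 1; funext j
    conv_lhs => rw [hhv, bil_real_smul_left, mul_pow]
  have h4 : G h x = ‖h‖ ^ 2 * G v x := by
    rw [← hG ⟨0, hN⟩, ← hG ⟨0, hN⟩, ← integral_const_mul]
    congr 1; funext ω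
    conv_lhs => rw [hhv, bil_real_smul_left, mul_pow]
  rw [h3, h4, netError]
  nlinarith [mul_le_mul_of_nonneg_left h1 (sq_nonneg ‖h‖)]

/-- Here y varies with h, so the net lives in the space of pairs, of real dimension at most 4d.
Writing y = 2θ₂ puts ‖y‖ ≤ 2 into the unit ball; net points have norm at most 2, so directions of
length up to 4 occur. -/
theorem exists_forall_le_avg_bil_sq (hN : 0 < N) (hind : iIndepFun a μ)
    (ha : ∀ j, HasSqExpMoment μ (a j) l) (hG : ∀ j h y, ∫ ω, bil (a j ω) h y ^ 2 ∂μ = G h y)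
    {t : ℝ} (hlam : 0 ≤ lam) (hlamV : lam * varBound l ≤ t / 2) (k : ℕ) :
    ∃ B : Set Ω, μ.real B ≤ 5 ^ (k * (4 * d)) * Real.exp (-(N * lam * t / 2)) ∧
      ∀ ω ∉ B, ∀ M, (∀ j, ‖a j ω‖ ^ 2 ≤ M) → ∀ h y, ‖y‖ ≤ 2 →
        G h y - (t + netError d l M k) * ‖h‖ ^ 2 ≤ avg (fun j => bil (a j ω) h y ^ 2) := by
  have hl := (ha ⟨0, hN⟩).pos
  have hsm : ∀ {y : Signal 𝕜 d}, ‖y‖ ≤ 2 → ‖(2 : ℝ) • y‖ ≤ 4 := fun hy => by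
    rw [norm_smul]; norm_num; linarith
  have hdiff : ∀ θ θ' : Signal 𝕜 d × Signal 𝕜 d,
      ‖θ.1 - θ'.1‖ ≤ ‖θ' - θ‖ ∧ ‖(2 : ℝ) • θ.2 - (2 : ℝ) • θ'.2‖ ≤ 2 * ‖θ' - θ‖ := fun θ θ' => by
    rw [norm_sub_rev θ', ← smul_sub, norm_smul, Real.norm_of_nonneg (by norm_num : (0 : ℝ) ≤ 2)]
    exact ⟨norm_fst_le (θ - θ'), by gcongr; exact norm_snd_le (θ - θ')⟩
  obtain ⟨B, hB, hgood⟩ := exists_uniform_avg_le (F := Signal 𝕜 d × Signal 𝕜 d) hN hind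
    (fun j => (ha j).aemeasurable) (f := fun θ e => -bil e θ.1 ((2 : ℝ) • θ.2) ^ 2)
    (fun θ => ((continuous_bil _ _).pow 2).neg.measurable)
    (m := fun θ => -G θ.1 ((2 : ℝ) • θ.2)) (C := 128)
    (C' := 128 * (1 + 4 * d ^ 2 / l ^ 2)) hlam hlamV (by norm_num) (by positivity)
    (fun θ hθ j => by
      rw [← hG j]
      exact chernoffBound_neg_bil (ha j) (((norm_fst_le θ).trans hθ).trans (by norm_num))
        (hsm ((norm_snd_le θ).trans hθ)))
    (fun θ θ' hθ hθ' e => by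
      have h1 := bil_sq_sub_le e θ'.1 θ.1 ((2 : ℝ) • θ'.2) ((2 : ℝ) • θ.2)
        ((norm_fst_le θ').trans hθ') ((norm_fst_le θ).trans hθ)
        (hsm ((norm_snd_le θ').trans hθ')) (hsm ((norm_snd_le θ).trans hθ))
        (hdiff θ' θ).1 (hdiff θ' θ).2
      have h2 : 0 ≤ 128 * ‖θ - θ'‖ := by positivity
      nlinarith)
    (fun θ θ' hθ hθ' => by
      rw [← hG ⟨0, hN⟩, ← hG ⟨0, hN⟩]
      have := integral_bil_sq_sub_le (ha ⟨0, hN⟩) θ'.1 θ.1 ((2 : ℝ) • θ'.2) ((2 : ℝ) • θ.2)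
        ((norm_fst_le θ').trans hθ') ((norm_fst_le θ).trans hθ)
        (hsm ((norm_snd_le θ').trans hθ')) (hsm ((norm_snd_le θ).trans hθ))
        (hdiff θ' θ).1 (hdiff θ' θ).2
      linarith) k
  have hrank : Module.finrank ℝ (Signal 𝕜 d × Signal 𝕜 d) ≤ 4 * d := by
    rw [Module.finrank_prod]
    have := finrank_signal_le (𝕜 := 𝕜) (d := d)
    omega
  refine ⟨B, hB.trans (card_mul_exp_le hrank _ _), ?_⟩
  intro ω hω M hM h y hy
  obtain ⟨v, hv, hhv⟩ := exists_eq_norm_smul h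
  have hy2 : ‖(1 / 2 : ℝ) • y‖ ≤ 1 := by rw [norm_smul]; norm_num; linarith
  have h1 := hgood ω hω M hM (v, (1 / 2 : ℝ) • y) (by
    rw [Prod.norm_def]; exact max_le hv hy2)
  simp only [smul_smul] at h1
  norm_num at h1
  rw [avg_neg] at h1
  have h3 : avg (fun j => bil (a j ω) h y ^ 2) = ‖h‖ ^ 2 * avg fun j => bil (a j ω) v y ^ 2 := by
    rw [← avg_const_mul]
    congr 1; funext j
    conv_lhs => rw [hhv, bil_real_smul_left, mul_pow]
  have h4 : G h y = ‖h‖ ^ 2 * G v y := by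
    rw [← hG ⟨0, hN⟩, ← hG ⟨0, hN⟩, ← integral_const_mul]
    congr 1; funext ω
    conv_lhs => rw [hhv, bil_real_smul_left, mul_pow]
  have h5 : G v y - (t + netError d l M k) ≤ avg fun j => bil (a j ω) v y ^ 2 := by
    rw [netError]; linarith
  rw [h3, h4]
  nlinarith [mul_le_mul_of_nonneg_left h5 (sq_nonneg ‖h‖)]

theorem exists_forall_avg_sq_le (hN : 0 < N) (hind : iIndepFun a μ)
    (ha : ∀ j, HasSqExpMoment μ (a j) l) {τ₁ : ℝ}
    (hτ : ∀ j h, ∫ ω, ‖inner 𝕜 (a j ω) h‖ ^ 2 ∂μ = τ₁ * ‖h‖ ^ 2)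
    {t : ℝ} (hlam : 0 ≤ lam) (hT : lam ≤ l / 4) (hlamV : lam * varBound l ≤ t / 2) (k : ℕ) :
    ∃ B : Set Ω, μ.real B ≤ 5 ^ (k * (4 * d)) * Real.exp (-(N * lam * t / 2)) ∧
      ∀ ω ∉ B, ∀ M, (∀ j, ‖a j ω‖ ^ 2 ≤ M) → ∀ h,
        avg (fun j => ‖inner 𝕜 (a j ω) h‖ ^ 2) ≤ (τ₁ + (t + netError d l M k)) * ‖h‖ ^ 2 := by
  have hl := (ha ⟨0, hN⟩).pos
  obtain ⟨B, hB, hgood⟩ := exists_uniform_avg_le (F := Signal 𝕜 d) hN hind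
    (fun j => (ha j).aemeasurable) (f := fun h e => ‖inner 𝕜 e h‖ ^ 2)
    (fun h => ((continuous_norm_inner h).pow 2).measurable) (m := fun h => τ₁ * ‖h‖ ^ 2) (C := 128)
    (C' := 128 * (1 + 4 * d ^ 2 / l ^ 2)) hlam hlamV (by norm_num) (by positivity)
    (fun h hh j => by
      simp only [← hτ j]
      exact chernoffBound_sq (ha j) hT (hh.trans (by norm_num)))
    (fun h h' hh hh' e => norm_inner_sq_sub_le e h h' hh hh')
    (fun h h' hh hh' => by
      simp only [← hτ ⟨0, hN⟩]
      exact integral_norm_inner_sq_sub_le (ha _) h h' hh hh') k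
  refine ⟨B, hB.trans (card_mul_exp_le (finrank_signal_le.trans (by omega)) _ _), ?_⟩
  intro ω hω M hM h
  obtain ⟨v, hv, hhv⟩ := exists_eq_norm_smul h
  have h1 := hgood ω hω M hM v hv
  have h3 : avg (fun j => ‖inner 𝕜 (a j ω) h‖ ^ 2) =
      ‖h‖ ^ 2 * avg fun j => ‖inner 𝕜 (a j ω) v‖ ^ 2 := by
    rw [← avg_const_mul]
    congr 1; funext j
    conv_lhs => rw [hhv, inner_smul_right_eq_smul, norm_smul, norm_norm, mul_pow]
  have h4 : τ₁ * ‖v‖ ^ 2 * ‖h‖ ^ 2 = τ₁ * ‖h‖ ^ 2 := by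
    conv_rhs => rw [hhv, norm_smul, norm_norm]
    ring
  rw [h3, netError]
  nlinarith [mul_le_mul_of_nonneg_left h1 (sq_nonneg ‖h‖)]

end Families

/-! ### Contraction on a good sample, and the sample size. -/

section Assembly

variable {𝕜 : Type*} [RCLike 𝕜] {d N : ℕ}

theorem norm_I_smul_le (u : Signal 𝕜 d) : ‖(RCLike.I : 𝕜) • u‖ ≤ ‖u‖ := by
  rw [norm_smul]
  refine mul_le_of_le_one_left (norm_nonneg _) ?_
  by_cases h : (RCLike.I : 𝕜) = 0
  · simp [h]
  · exact (RCLike.norm_I_of_ne_zero h).le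

/-- Contraction of the iterates for a sample on which the empirical second and fourth order forms
are close to their expectations `G`. -/
theorem phaseDist_flow_le_of_concentration (a : Fin N → Signal 𝕜 d) {x : Signal 𝕜 d} (hx : ‖x‖ = 1)
    {G : Signal 𝕜 d → Signal 𝕜 d → ℝ} {δ η τ₁ τ₂ τ₃ τ₄ : ℝ} (hδ : 0 < δ)
    (hδβ : δ < betaConst τ₃ τ₄) (hη : η ≤ δ / 20) (h₁ : 0 ≤ τ₁) (h₂ : 0 ≤ τ₂)
    (hcurv : ∀ h, ‖h‖ ≤ epsZero τ₂ τ₃ τ₄ → RCLike.im (inner 𝕜 h x) = 0 →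
      betaConst τ₃ τ₄ / 2 * ‖h‖ ^ 2 ≤ 5 / 2 * G h (x + (3 / 5 : ℝ) • h) - 1 / 2 * G h x)
    (hG : ∀ u, G u x + G ((RCLike.I : 𝕜) • u) x ≤ alphaHat τ₂ τ₃ τ₄ * ‖u‖ ^ 2)
    (hη0 : 0 ≤ η)
    (hU : ∀ h, avg (fun j => bil (a j) h x ^ 2) ≤ G h x + η * ‖h‖ ^ 2)
    (hL : ∀ h y, ‖y‖ ≤ 2 → G h y - η * ‖h‖ ^ 2 ≤ avg (fun j => bil (a j) h y ^ 2))
    (hS : ∀ h, avg (fun j => ‖inner 𝕜 (a j) h‖ ^ 2) ≤ 2 * τ₁ * ‖h‖ ^ 2)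
    (hM : ∀ j, ‖a j‖ ^ 2 ≤ d * Real.log N)
    {z : Signal 𝕜 d} (hz : z ∈ nbhd x (epsZero τ₂ τ₃ τ₄)) {ξ : ℝ} (hξ : 0 < ξ)
    (hξR : ξ ≤ 2 / stepConst d N δ τ₁ τ₂ τ₃ τ₄) (k : ℕ) :
    phaseDist (wirtingerFlow a x ξ z (k + 1)) x ^ 2 ≤
      (1 - ξ * (betaConst τ₃ τ₄ - δ) / 4) * phaseDist (wirtingerFlow a x ξ z k) x ^ 2 := by
  have hβ : 0 < betaConst τ₃ τ₄ := hδ.trans hδβ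
  have hαβ : betaConst τ₃ τ₄ ≤ alphaHat τ₂ τ₃ τ₄ :=
    (betaConst_le_alphaConst h₂).trans alphaConst_le_alphaHat
  have hlog : 0 ≤ (d : ℝ) * Real.log N := mul_nonneg (by positivity) (Real.log_natCast_nonneg N)
  have hb : 0 < betaConst τ₃ τ₄ - δ := sub_pos.2 hδβ
  set β := betaConst τ₃ τ₄ with hβd
  set A := alphaHat τ₂ τ₃ τ₄ with hA
  set ε := epsZero τ₂ τ₃ τ₄ with hε
  set R := stepConst d N δ τ₁ τ₂ τ₃ τ₄ with hR
  have hA0 : 0 < A := hβ.trans_le hαβ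
  have hR1 : 96 * (A ^ 2 * (1 + δ ^ 2) / (β - δ)) ≤ R := le_max_left _ _
  have hR2 : 270 * A * (1 + δ) + 60 * d * Real.log N * τ₁ * (1 + δ) * ε ^ 2 ≤ R := le_max_right _ _
  have hV0 : 0 ≤ 2 * τ₁ * (d * Real.log N) * ε ^ 2 := by positivity
  -- The factor 11/10 leaves room for the deviation 2η ≤ A/10. The conditions on R hold because
  -- (128/3)(11/10)² < 96, 240 · 11/10 < 270 and (80/3) · 2 < 60.
  refine phaseDist_flow_le a x hx (W := 11 / 10 * A) (V := 2 * τ₁ * (d * Real.log N) * ε ^ 2)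
    (lt_of_lt_of_le (by positivity) hR1) (by positivity) hV0 hb.le ?_ ?_ ?_ ?_ ?_ hz hξ hξR k
  · have h3 : 96 * (A ^ 2 * (1 + δ ^ 2)) ≤ R * (β - δ) := by
      rw [← mul_div_assoc, div_le_iff₀ hb] at hR1
      exact hR1
    nlinarith [sq_nonneg (A * δ), sq_nonneg A]
  · have h4 : 0 ≤ A * δ := by positivity
    have h5 : 0 ≤ 2 * τ₁ * (d * Real.log N) * ε ^ 2 * δ := by positivity
    nlinarith
  · intro u
    -- The bound on squared real parts, applied to u and to iu, controls the full modulus. Over ℝ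
    -- the constant `RCLike.I` is 0 and the second term vanishes.
    have h6 : avg (fun j => ‖inner 𝕜 (a j) u‖ ^ 2 * ‖inner 𝕜 (a j) x‖ ^ 2) =
        avg (fun j => bil (a j) u x ^ 2) +
          avg (fun j => bil (a j) ((RCLike.I : 𝕜) • u) x ^ 2) := by
      rw [← avg_add]
      simp only [bil_sq_add_bil_I_sq]
    have h7 : ‖(RCLike.I : 𝕜) • u‖ ^ 2 ≤ ‖u‖ ^ 2 :=
      pow_le_pow_left₀ (norm_nonneg _) (norm_I_smul_le u) 2
    rw [h6]
    have h8 := hU ((RCLike.I : 𝕜) • u)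
    have h9 : (2 * η) * ‖u‖ ^ 2 ≤ (1 / 10 * A) * ‖u‖ ^ 2 :=
      mul_le_mul_of_nonneg_right (by linarith) (sq_nonneg _)
    have h10 := mul_le_mul_of_nonneg_left h7 hη0
    linarith [hU u, hG u]
  · intro h u hh
    have h11 : ∀ j, ‖inner 𝕜 (a j) h‖ ^ 2 ≤ d * Real.log N * ε ^ 2 := fun j => by
      calc _ ≤ (‖a j‖ * ‖h‖) ^ 2 := by gcongr; exact norm_inner_le_norm _ _
        _ = ‖a j‖ ^ 2 * ‖h‖ ^ 2 := by ring
        _ ≤ _ := by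
          gcongr
          exact hM j
    calc _ ≤ avg fun j => d * Real.log N * ε ^ 2 * ‖inner 𝕜 (a j) u‖ ^ 2 :=
          avg_mono fun j => by
            rw [mul_comm]
            exact mul_le_mul_of_nonneg_right (h11 j) (by positivity)
      _ ≤ d * Real.log N * ε ^ 2 * (2 * τ₁ * ‖u‖ ^ 2) := by
          rw [avg_const_mul]
          exact mul_le_mul_of_nonneg_left (hS u) (by positivity)
      _ = _ := by ring
  · intro h hh him
    have hh1 := le_one_of_le_epsZero h₂ hβ (norm_nonneg h) hh
    have hy : ‖x + (3 / 5 : ℝ) • h‖ ≤ 2 := by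
      refine (norm_add_le _ _).trans ?_
      rw [norm_smul, hx]
      norm_num
      linarith
    have e₁ := hL h _ hy
    have e₂ := hU h
    have e₃ := hcurv h hh him
    -- The weight 3/5 reproduces the cross term, (5/2)(6/5) = 3, and leaves 1 - (5/2)(9/25) = 1/10
    -- of the quartic term.
    have hdecomp : (avg fun j => 2 * bil (a j) h x ^ 2 +
          3 * (bil (a j) h x * ‖inner 𝕜 (a j) h‖ ^ 2) + (‖inner 𝕜 (a j) h‖ ^ 2) ^ 2) =
        5 / 2 * avg (fun j => bil (a j) h (x + (3 / 5 : ℝ) • h) ^ 2) -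
          1 / 2 * avg (fun j => bil (a j) h x ^ 2) +
          1 / 10 * avg (fun j => (‖inner 𝕜 (a j) h‖ ^ 2) ^ 2) := by
      rw [← avg_const_mul, ← avg_const_mul, ← avg_const_mul, ← avg_sub, ← avg_add]
      congr 1
      funext j
      rw [bil_add_right, bil_real_smul_right, bil_self]
      ring
    rw [hdecomp]
    have h12 : 3 * η * ‖h‖ ^ 2 ≤ δ / 2 * ‖h‖ ^ 2 :=
      mul_le_mul_of_nonneg_right (by linarith) (sq_nonneg _)
    linarith

/-- A sample size of order `d log² d` is at least of order `d log² N`. -/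
theorem exists_sample_size (A B : ℝ) : ∃ C : ℝ, 0 < C ∧ ∀ d N : ℕ, 2 ≤ d →
    C * d * Real.log d ^ 2 ≤ N → A * d * Real.log N ^ 2 ≤ N ∧ B ≤ Real.log N ∧ B ≤ N ∧ d ≤ N ∧
      0 < N := by
  set A' := max A 1
  -- The first summand serves the case N ≤ d⁴, the second forces log N ≥ B, and the third serves N >
  -- d⁴.
  set C := 16 * A' + 4 * Real.exp (max B 1) + 4 * (64 * A') ^ 2 with hC
  have hA' : 1 ≤ A' := le_max_right _ _
  have hAA : A ≤ A' := le_max_left _ _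
  refine ⟨C, by positivity, fun d N hd h => ?_⟩
  have hd2 : (2 : ℝ) ≤ d := by exact_mod_cast hd
  have hlog2 : (1 / 2 : ℝ) ≤ Real.log 2 := by linarith [Real.log_two_gt_d9]
  have hlogd : 1 / 2 ≤ Real.log d := hlog2.trans (Real.log_le_log (by norm_num) hd2)
  have hN1 : C * d * (1 / 4) ≤ N := by
    refine le_trans ?_ h
    have : (1 / 4 : ℝ) ≤ Real.log d ^ 2 := by nlinarith
    gcongr
  have hCexp : Real.exp (max B 1) ≤ C * 2 * (1 / 4) := by
    have := Real.exp_pos (max B 1)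
    nlinarith [sq_nonneg (64 * A')]
  have hCsq : (64 * A') ^ 2 ≤ C * 2 * (1 / 4) := by
    have := Real.exp_pos (max B 1)
    nlinarith [sq_nonneg (64 * A')]
  have hC0 : 0 ≤ C := by positivity
  have hC2 : C * 2 * (1 / 4) ≤ C * d * (1 / 4) := by gcongr
  have hNexp : Real.exp (max B 1) ≤ N := by linarith
  have hNpos : (0 : ℝ) < N := (Real.exp_pos _).trans_le hNexp
  have hBlog : max B 1 ≤ Real.log N := (Real.le_log_iff_exp_le hNpos).2 hNexp
  have hlogN : Real.log N ≤ N := (Real.log_le_sub_one_of_pos hNpos).trans (by linarith)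
  have hdN : (d : ℝ) ≤ N := by
    refine le_trans ?_ hN1
    have := Real.exp_pos (max B 1)
    nlinarith [sq_nonneg (64 * A')]
  have hlogN0 : 0 ≤ Real.log N := (zero_le_one.trans (le_max_right B 1)).trans hBlog
  refine ⟨?_, (le_max_left _ _).trans hBlog, ((le_max_left _ _).trans hBlog).trans hlogN,
    by exact_mod_cast hdN, by exact_mod_cast hNpos⟩
  suffices hmain : A' * d * Real.log N ^ 2 ≤ N from
    le_trans (by gcongr) hmain
  -- For N ≤ d⁴, log N and log d are comparable. Otherwise d < N^(1/4), and log N ≤ 8N^(1/8)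
  -- suffices.
  by_cases hcase : (N : ℝ) ≤ d ^ 4
  · have h1 : Real.log N ≤ 4 * Real.log d := by
      have := Real.log_le_log hNpos hcase
      rwa [Real.log_pow] at this
    refine le_trans ?_ h
    calc A' * d * Real.log N ^ 2 ≤ A' * d * (4 * Real.log d) ^ 2 := by gcongr
      _ = 16 * A' * d * Real.log d ^ 2 := by ring
      _ ≤ C * d * Real.log d ^ 2 := by
        gcongr
        have := Real.exp_pos (max B 1)
        nlinarith [sq_nonneg (64 * A')]
  · push Not at hcase
    set s := (N : ℝ) ^ (1 / 8 : ℝ) with hs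
    have hs0 : 0 < s := Real.rpow_pos_of_pos hNpos _
    have hs8 : s ^ 8 = N := by
      rw [hs, ← Real.rpow_natCast, ← Real.rpow_mul hNpos.le]; norm_num
    have h1 : Real.log N ≤ 8 * s := by
      rw [← hs8, Real.log_pow]
      have := Real.log_le_sub_one_of_pos hs0
      push_cast
      linarith
    have h2 : (d : ℝ) ≤ s ^ 2 := by
      have : (d : ℝ) ^ 4 ≤ (s ^ 2) ^ 4 := by rw [← pow_mul, hs8]; exact hcase.le
      exact le_of_pow_le_pow_left₀ (by norm_num) (by positivity) this
    have h3 : 64 * A' ≤ s ^ 4 := by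
      have : (64 * A') ^ 2 ≤ (s ^ 4) ^ 2 := by rw [← pow_mul, hs8]; linarith
      exact le_of_pow_le_pow_left₀ (by norm_num) (by positivity) this
    calc A' * d * Real.log N ^ 2 ≤ A' * s ^ 2 * (8 * s) ^ 2 := by gcongr
      _ = 64 * A' * s ^ 4 := by ring
      _ ≤ s ^ 4 * s ^ 4 := by gcongr
      _ = N := by rw [← hs8]; ring

end Assembly

/-! ### Choice of parameters and numerical estimates. -/

section Numerics

theorem five_pow_le_exp (n : ℕ) : (5 : ℝ) ^ n ≤ Real.exp (2 * n) := by
  have h : (5 : ℝ) ≤ Real.exp 2 := by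
    have h1 := Real.exp_one_gt_d9
    have h2 : Real.exp 2 = Real.exp 1 * Real.exp 1 := by rw [← Real.exp_add]; norm_num
    rw [h2]; nlinarith
  calc (5 : ℝ) ^ n ≤ Real.exp 2 ^ n := by gcongr
    _ = _ := by rw [← Real.exp_nat_mul]; congr 1; ring

variable {d N : ℕ} {l t : ℝ}

/-- The entropy is at most 8d⌈10 log N⌉ ≤ 88 d log N, while the hypothesis makes the exponent at
least 92 d log N (3680 = 92 · 40). -/
theorem net_card_mul_exp_le (hl : 0 < l) (ht : 0 < t) (hd : 1 ≤ d) (hlog : 1 ≤ Real.log N)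
    (hN : 3680 / (l ^ 2 * t) * d * Real.log N ^ 2 ≤ N) :
    (5 : ℝ) ^ (⌈10 * Real.log N⌉₊ * (4 * d)) *
      Real.exp (-(N * (l ^ 2 / (20 * Real.log N)) * t / 2)) ≤ Real.exp (-4 * Real.log N) := by
  have hd' : (1 : ℝ) ≤ d := by exact_mod_cast hd
  have hk : (⌈10 * Real.log N⌉₊ : ℝ) ≤ 11 * Real.log N := by
    have := (Nat.ceil_lt_add_one (by linarith : 0 ≤ 10 * Real.log N)).le
    linarith
  refine (mul_le_mul_of_nonneg_right (five_pow_le_exp _) (Real.exp_pos _).le).trans ?_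
  rw [← Real.exp_add]
  refine Real.exp_le_exp.2 ?_
  push_cast
  have h1 : 92 * d * Real.log N ≤ N * (l ^ 2 / (20 * Real.log N)) * t / 2 := by
    have h2 : N * (l ^ 2 / (20 * Real.log N)) * t / 2 = N * (l ^ 2 * t / (40 * Real.log N)) := by
      field_simp; ring
    have h3 : 92 * d * Real.log N = 3680 / (l ^ 2 * t) * d * Real.log N ^ 2 *
        (l ^ 2 * t / (40 * Real.log N)) := by field_simp; norm_num
    rw [h2, h3]
    gcongr
  have h4 : 2 * ((⌈10 * Real.log N⌉₊ : ℝ) * (4 * d)) ≤ 88 * d * Real.log N := by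
    nlinarith [mul_le_mul_of_nonneg_right hk (by linarith : (0 : ℝ) ≤ d)]
  nlinarith [mul_le_mul_of_nonneg_right hd' (by linarith : 0 ≤ Real.log N)]

/-- Half of the exponent l d log N / 4 pays for 4d, since log N ≥ 32/l; the other half pays for 5
log N, since d ≥ 40/l. -/
theorem maximal_norm_bound_le (hl : 0 < l) (hN : 0 < N) (hd : 40 / l ≤ d)
    (hlog : 32 / l ≤ Real.log N) :
    (5 : ℝ) ^ (2 * d) * (N * (2 * Real.exp (-(l * (d * Real.log N / 4))))) ≤
      2 * Real.exp (-4 * Real.log N) := by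
  have hN' : (0 : ℝ) < N := by exact_mod_cast hN
  rw [div_le_iff₀ hl] at hd hlog
  have hlog0 : 0 ≤ Real.log N := Real.log_natCast_nonneg N
  calc _ ≤ Real.exp (2 * (2 * d : ℕ)) *
        (Real.exp (Real.log N) * (2 * Real.exp (-(l * (d * Real.log N / 4))))) := by
        rw [Real.exp_log hN']
        gcongr
        exact five_pow_le_exp _
    _ = 2 * Real.exp (4 * d + Real.log N - l * (d * Real.log N / 4)) := by
        rw [sub_eq_add_neg, Real.exp_add, Real.exp_add]
        push_cast
        rw [show (2 : ℝ) * (2 * d) = 4 * d by ring]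
        ring
    _ ≤ _ := by
        gcongr
        have h1 := mul_le_mul_of_nonneg_right hd hlog0
        have h2 := mul_le_mul_of_nonneg_right hlog (Nat.cast_nonneg (α := ℝ) d)
        nlinarith

/-- As 10 log 2 ≥ 6, the scale is at most N⁻⁶, against Lipschitz constants of order N⁴. -/
theorem netError_le (hl : 0 < l) (ht : 0 < t) (hN : 0 < N) (hdN : d ≤ N)
    (hNt : 128 * (3 + 4 / l ^ 2) / t ≤ N) :
    netError d l (d * Real.log N) ⌈10 * Real.log N⌉₊ ≤ t := by
  have hN1 : (1 : ℝ) ≤ N := by exact_mod_cast hN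
  have hN' : (0 : ℝ) < N := by linarith
  have hd : (d : ℝ) ≤ N := by exact_mod_cast hdN
  have hlog0 : 0 ≤ Real.log N := Real.log_natCast_nonneg N
  have hlogN : Real.log N ≤ N := (Real.log_le_sub_one_of_pos hN').trans (by linarith)
  have hk : (1 / 2 : ℝ) ^ ⌈10 * Real.log N⌉₊ ≤ ((N : ℝ) ^ 6)⁻¹ := by
    rw [one_div, inv_pow]
    refine inv_anti₀ (by positivity) ?_
    have h2 : (N : ℝ) ^ 6 = Real.exp (6 * Real.log N) := by
      rw [← Real.exp_log (pow_pos hN' 6), Real.log_pow]; norm_num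
    have h3 : (2 : ℝ) ^ ⌈10 * Real.log N⌉₊ = Real.exp (⌈10 * Real.log N⌉₊ * Real.log 2) := by
      rw [Real.exp_nat_mul, Real.exp_log (by norm_num)]
    rw [h2, h3]
    refine Real.exp_le_exp.2 ?_
    nlinarith [Nat.le_ceil (10 * Real.log N), Real.log_two_gt_d9]
  have hM : (d * Real.log N) ^ 2 ≤ (N : ℝ) ^ 4 := by
    calc (d * Real.log N) ^ 2 ≤ ((N : ℝ) * N) ^ 2 := by gcongr
      _ = _ := by ring
  have h1N : (1 : ℝ) ≤ (N : ℝ) ^ 4 := one_le_pow₀ hN1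
  have hd2 : 4 * (d : ℝ) ^ 2 / l ^ 2 ≤ 4 / l ^ 2 * (N : ℝ) ^ 4 := by
    rw [div_mul_eq_mul_div]
    have : (d : ℝ) ^ 2 ≤ (N : ℝ) ^ 4 :=
      (pow_le_pow_left₀ (by positivity) hd 2).trans (pow_le_pow_right₀ hN1 (by norm_num))
    gcongr
  have hsum : 128 * (1 + (d * Real.log N) ^ 2) + 128 * (1 + 4 * (d : ℝ) ^ 2 / l ^ 2) ≤
      128 * (3 + 4 / l ^ 2) * (N : ℝ) ^ 4 := by nlinarith
  rw [div_le_iff₀ ht] at hNt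
  have hN2 : 128 * (3 + 4 / l ^ 2) ≤ t * (N : ℝ) ^ 2 := by
    nlinarith [mul_le_mul_of_nonneg_left hN1 (mul_pos hN' ht).le]
  calc netError d l (d * Real.log N) ⌈10 * Real.log N⌉₊
      ≤ (128 * (3 + 4 / l ^ 2) * (N : ℝ) ^ 4) * ((N : ℝ) ^ 6)⁻¹ := by
        unfold netError; gcongr
    _ ≤ (t * (N : ℝ) ^ 2 * (N : ℝ) ^ 4) * ((N : ℝ) ^ 6)⁻¹ := by gcongr
    _ = t := by field_simp

end Numerics

/-! ### The probability estimate. -/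

section Main

variable {𝕜 Ω : Type*} [RCLike 𝕜] [MeasurableSpace Ω] {d N : ℕ} {μ : Measure Ω}
  [IsProbabilityMeasure μ]

theorem one_sub_le_measureReal {S B : Set Ω} (h : ∀ ω ∉ B, ω ∈ S) : 1 - μ.real B ≤ μ.real S := by
  have h1 : (1 : ℝ) ≤ μ.real (S ∪ B) := by
    have : S ∪ B = Set.univ := Set.eq_univ_of_forall fun ω => by
      by_cases hω : ω ∈ B
      · exact Or.inr hω
      · exact Or.inl (h ω hω)
    rw [this, probReal_univ]
  linarith [measureReal_union_le (μ := μ) S B]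

/-- Five bad events: three failures on nets, each of probability at most N⁻⁴, and large values of
‖a_j‖² or of |a_j* x|², each at most 2N⁻⁴. -/
theorem le_measureReal_contraction {a : Fin N → Ω → Signal 𝕜 d} {τ₁ τ₂ τ₃ τ₄ l δ η : ℝ}
    (hind : iIndepFun a μ) (ha : ∀ j, HasSqExpMoment μ (a j) l)
    (hm : ∀ j, HasMoments μ (a j) τ₁ τ₂ τ₃ τ₄) (hδ : 0 < δ) (hδβ : δ < betaConst τ₃ τ₄)
    (hη0 : 0 < η) (hη : η ≤ δ / 20) (hητ : η ≤ δ ^ 2 * l ^ 3 / 12) (hl : 0 < l)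
    (hN : 0 < N) (hd2 : 2 ≤ d) (hdl : 40 / l ≤ d) (hdN : d ≤ N)
    (hNA : 3680 / (l ^ 2 * (η / 2)) * d * Real.log N ^ 2 ≤ N)
    (hlog : 1 ≤ Real.log N) (hlog1 : l ≤ Real.log N) (hlog2 : 32 / l ≤ Real.log N)
    (hlog3 : l ^ 2 * varBound l / (5 * η) ≤ Real.log N)
    (hNη : 128 * (3 + 4 / l ^ 2) / (η / 2) ≤ N) {x : Signal 𝕜 d} (hx : ‖x‖ = 1) :
    1 - 7 * Real.exp (-4 * Real.log N) ≤
      μ.real {ω | ∀ z₀ ∈ nbhd x (epsZero τ₂ τ₃ τ₄),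
        ∀ ξ : ℝ, 0 < ξ → ξ ≤ 2 / stepConst d N δ τ₁ τ₂ τ₃ τ₄ → ∀ k : ℕ,
          phaseDist (wirtingerFlow (fun j => a j ω) x ξ z₀ (k + 1)) x ^ 2 ≤
            (1 - ξ * (betaConst τ₃ τ₄ - δ) / 4) *
              phaseDist (wirtingerFlow (fun j => a j ω) x ξ z₀ k) x ^ 2} := by
  have hβ : 0 < betaConst τ₃ τ₄ := hδ.trans hδβ
  have hlogpos : 0 < Real.log N := by linarith
  have j₀ : Fin N := ⟨0, hN⟩
  have h₂ : 0 ≤ τ₂ := (hm j₀).nonneg_of_two_le (ha j₀) hd2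
  have h₃ : 0 ≤ τ₃ := by
    have : betaConst τ₃ τ₄ ≤ τ₃ := by unfold betaConst; linarith [le_max_right (-τ₄) 0]
    linarith
  have hτη : η ≤ τ₁ := hητ.trans ((hm j₀).le_second_moment (ha j₀) hx hδ
    (hδβ.le.trans (betaConst_le_alphaConst h₂)))
  set G : Signal 𝕜 d → Signal 𝕜 d → ℝ := fun h y => ∫ ω, bil (a j₀ ω) h y ^ 2 ∂μ with hGdef
  have hG : ∀ j h y, ∫ ω, bil (a j ω) h y ^ 2 ∂μ = G h y := fun j h y => by
    have e₁ := (hm j).integral_bil_sq (ha j) h y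
    have e₂ := (hm j₀).integral_bil_sq (ha j₀) h y
    rw [hGdef]
    linarith
  -- With this T the union bound over the sample gives N · 2N⁻⁵; `lam` is then l/(4T), and k makes
  -- 2⁻ᵏ ≤ N⁻⁶.
  set T : ℝ := 5 * Real.log N / l with hT
  set lam : ℝ := l ^ 2 / (20 * Real.log N) with hlam
  set k : ℕ := ⌈10 * Real.log N⌉₊ with hk
  have hlam0 : 0 ≤ lam := by positivity
  have hlamT : lam * T ≤ l / 4 := by
    rw [hlam, hT]; apply le_of_eq; field_simp; norm_num
  have hlaml : lam ≤ l / 4 := by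
    rw [hlam, div_le_div_iff₀ (by positivity) (by norm_num)]
    nlinarith
  have hlamV : lam * varBound l ≤ η / 2 / 2 := by
    rw [div_le_iff₀ (by positivity)] at hlog3
    rw [hlam, div_mul_eq_mul_div, div_le_iff₀ (by positivity)]
    linarith
  have hnet : netError d l (d * Real.log N) k ≤ η / 2 :=
    netError_le hl (by positivity) hN hdN hNη
  obtain ⟨B₁, hB₁, hU⟩ := exists_forall_avg_bil_sq_le hN hind ha hG hx hlam0 hlamT hlamV k
  obtain ⟨B₂, hB₂, hL⟩ := exists_forall_le_avg_bil_sq hN hind ha hG hlam0 hlamV k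
  obtain ⟨B₃, hB₃, hS⟩ := exists_forall_avg_sq_le hN hind ha
    (fun j h => (hm j).integral_sq (ha j) h) hlam0 hlaml hlamV k
  have hfail : (5 : ℝ) ^ (k * (4 * d)) * Real.exp (-(N * lam * (η / 2) / 2)) ≤
      Real.exp (-4 * Real.log N) :=
    net_card_mul_exp_le hl (by positivity) (by omega) hlog hNA
  set B₄ := {ω | ∃ j, d * Real.log N < ‖a j ω‖ ^ 2} with hB₄def
  have hB₄ : μ.real B₄ ≤ 2 * Real.exp (-4 * Real.log N) :=
    (measure_exists_norm_gt_le ha _).trans (maximal_norm_bound_le hl hN hdl hlog2)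
  set B₅ := {ω | ∃ j, T ≤ ‖inner 𝕜 (a j ω) x‖ ^ 2} with hB₅def
  have hB₅ : μ.real B₅ ≤ 2 * Real.exp (-4 * Real.log N) := by
    refine (measure_exists_inner_ge_le ha (by rw [hx]; norm_num) T).trans_eq ?_
    have hNpos : (0 : ℝ) < N := by exact_mod_cast hN
    have e₁ : -4 * Real.log N = Real.log N + -(l * T) := by rw [hT]; field_simp; norm_num
    rw [e₁, Real.exp_add, Real.exp_log hNpos]
    ring
  have hB : μ.real (B₁ ∪ B₂ ∪ B₃ ∪ B₄ ∪ B₅) ≤ 7 * Real.exp (-4 * Real.log N) := by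
    have e₁ := measureReal_union_le (μ := μ) (B₁ ∪ B₂ ∪ B₃ ∪ B₄) B₅
    have e₂ := measureReal_union_le (μ := μ) (B₁ ∪ B₂ ∪ B₃) B₄
    have e₃ := measureReal_union_le (μ := μ) (B₁ ∪ B₂) B₃
    have e₄ := measureReal_union_le (μ := μ) B₁ B₂
    linarith
  refine le_trans (by linarith) (one_sub_le_measureReal (B := B₁ ∪ B₂ ∪ B₃ ∪ B₄ ∪ B₅) ?_)
  intro ω hω z₀ hz₀ ξ hξ hξR n
  simp only [Set.mem_union, not_or] at hω
  obtain ⟨⟨⟨⟨hω₁, hω₂⟩, hω₃⟩, hω₄⟩, hω₅⟩ := hω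
  have hM : ∀ j, ‖a j ω‖ ^ 2 ≤ d * Real.log N := fun j => by
    by_contra! hcon
    exact hω₄ ⟨j, hcon⟩
  have hTω : ∀ j, ‖inner 𝕜 (a j ω) x‖ ^ 2 ≤ T := fun j => by
    by_contra! hcon
    exact hω₅ ⟨j, hcon.le⟩
  have herr : ∀ h : Signal 𝕜 d, (η / 2 + netError d l (d * Real.log N) k) * ‖h‖ ^ 2 ≤
      η * ‖h‖ ^ 2 := fun h => mul_le_mul_of_nonneg_right (by linarith) (sq_nonneg _)
  refine phaseDist_flow_le_of_concentration (fun j => a j ω) hx (G := G) hδ hδβ hη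
    (hη0.le.trans hτη) h₂ (fun h hh him => (hm j₀).le_integral_curvature (ha j₀) h₂ hβ hx him hh)
    ?_ hη0.le ?_ ?_ ?_ hM hz₀ hξ hξR n
  · intro u
    rw [hGdef]
    simp only
    rw [← integral_add (integrable_bil_sq (ha j₀) _ _) (integrable_bil_sq (ha j₀) _ _)]
    simp only [bil_sq_add_bil_I_sq]
    exact (hm j₀).integral_mul_sq_le (ha j₀) h₃ hx u
  · intro h
    linarith [hU ω hω₁ _ hM hTω h, herr h]
  · intro h y hy
    linarith [hL ω hω₂ _ hM h y hy, herr h]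
  · intro h
    have := mul_le_mul_of_nonneg_right hτη (sq_nonneg ‖h‖)
    linarith [hS ω hω₃ _ hM h, herr h]

end Main

end PhaseRetrieval

open PhaseRetrieval
theorem proposition3p4 {𝕜 : Type*} [RCLike 𝕜] (K : ℝ≥0) :
    ∃ c : ℝ, 0 < c ∧ ∀ δ : ℝ, 0 < δ → ∃ cδ Cδ : ℝ, 0 < cδ ∧ 0 < Cδ ∧
      ∀ {d N : ℕ} {Ω : Type*} [MeasurableSpace Ω] (μ : Measure Ω) [IsProbabilityMeasure μ]
        (a : Fin N → Ω → Signal 𝕜 d) (τ₁ τ₂ τ₃ τ₄ : ℝ),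
        ConditionI μ a → ConditionII μ a τ₁ τ₂ τ₃ τ₄ →
        (∀ j, psiTwoNorm μ (a j) ≤ (K : ℝ≥0∞)) →
        δ < betaConst τ₃ τ₄ →
        Cδ * d * Real.log d ^ 2 ≤ (N : ℝ) →
        ∀ x : Signal 𝕜 d, ‖x‖ = 1 →
          1 - 1 / (d : ℝ) ^ 3 - Real.exp (-c * d) - 2 * Real.exp (-cδ * N) <
            μ.real {ω | ∀ z₀ ∈ nbhd x (epsZero τ₂ τ₃ τ₄),
              ∀ ξ : ℝ, 0 < ξ → ξ ≤ 2 / stepConst d N δ τ₁ τ₂ τ₃ τ₄ → ∀ k : ℕ,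
                phaseDist (wirtingerFlow (fun j => a j ω) x ξ z₀ (k + 1)) x ^ 2 ≤
                  (1 - ξ * (betaConst τ₃ τ₄ - δ) / 4) *
                    phaseDist (wirtingerFlow (fun j => a j ω) x ξ z₀ k) x ^ 2} := by
  set l : ℝ := 1 / (192 * ((K : ℝ) + 1) ^ 2) with hldef
  have hl : 0 < l := by positivity
  have hl1 : l ≤ 1 := by
    have hK := K.coe_nonneg
    rw [hldef, div_le_one (by positivity)]
    nlinarith
  -- This c satisfies cd⁴ ≤ 1 whenever d < 40/l, so that exp(-cd) ≥ 1 - cd ≥ 1 - d⁻³ for such d ≥ 1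
  -- and the claim is trivial there.
  refine ⟨(l / 40) ^ 4, by positivity, fun δ hδ => ?_⟩
  -- The first bound keeps the deviations below the slack δ; the second, through
  -- `HasMoments.le_second_moment`, gives η ≤ τ₁.
  set η : ℝ := min (δ / 20) (δ ^ 2 * l ^ 3 / 12) with hηdef
  have hη0 : 0 < η := lt_min (by positivity) (by positivity)
  set B : ℝ := 7 + 32 / l + max (l ^ 2 * varBound l / (5 * η)) 0 +
    128 * (3 + 4 / l ^ 2) / (η / 2) with hBdef
  obtain ⟨C, hC, hsize⟩ := exists_sample_size (3680 / (l ^ 2 * (η / 2))) B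
  -- All failures fit into d⁻³, so any positive c_δ would do.
  refine ⟨1, C, one_pos, hC, ?_⟩
  intro d N Ω _ μ _ a τ₁ τ₂ τ₃ τ₄ hI hII hK hδβ hCN x hx
  have hexpN := Real.exp_pos (-1 * (N : ℝ))
  by_cases hdl : 40 / l ≤ d
  · have hd2 : 2 ≤ d := by
      have h40 : (40 : ℝ) ≤ 40 / l := by
        rw [le_div_iff₀ hl]; nlinarith
      have : (2 : ℝ) ≤ d := by linarith
      exact_mod_cast this
    obtain ⟨hNA, hBlog, hBN, hdN, hN⟩ := hsize d N hd2 hCN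
    have p₁ : 0 < 32 / l := by positivity
    have p₂ : 0 ≤ max (l ^ 2 * varBound l / (5 * η)) 0 := le_max_right _ _
    have p₃ := le_max_left (l ^ 2 * varBound l / (5 * η)) 0
    have p₄ : 0 < 128 * (3 + 4 / l ^ 2) / (η / 2) := by positivity
    have hmain := le_measureReal_contraction (μ := μ) (a := a) (l := l) (δ := δ) (η := η) hI.indep
      (fun j => hasSqExpMoment_of_psiTwoNorm_le (hI.identDistrib j j).aemeasurable_fst (hK j))
      (fun j => ⟨hII.second_moment j, hII.fourth_moment j⟩) hδ hδβ hη0 (min_le_left _ _)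
      (min_le_right _ _) hl hN hd2 hdl hdN hNA (by linarith) (by linarith) (by linarith)
      (by linarith) (by linarith) hx
    refine lt_of_lt_of_le ?_ hmain
    have hNpos : (0 : ℝ) < N := by exact_mod_cast hN
    have hdpos : (0 : ℝ) < d := by positivity
    have h7 : 7 * Real.exp (-4 * Real.log N) ≤ 1 / (d : ℝ) ^ 3 := by
      have e₁ : Real.exp (-4 * Real.log N) = ((N : ℝ) ^ 4)⁻¹ := by
        rw [neg_mul, Real.exp_neg, mul_comm, ← Real.rpow_def_of_pos hNpos]
        norm_cast
      have hdN' : (d : ℝ) ≤ N := by exact_mod_cast hdN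
      rw [e₁, ← div_eq_mul_inv, div_le_div_iff₀ (by positivity) (by positivity)]
      calc 7 * (d : ℝ) ^ 3 ≤ N * (N : ℝ) ^ 3 := by gcongr; linarith
        _ = 1 * (N : ℝ) ^ 4 := by ring
    have := Real.exp_pos (-(l / 40) ^ 4 * (d : ℝ))
    linarith
  -- Small d: the left side is negative, with strictness from exp(-N). For d = 0 the term 1/d³ is 0
  -- by convention, but exp(-cd) = 1.
  · refine lt_of_lt_of_le ?_ measureReal_nonneg
    push Not at hdl
    have hcd : (l / 40) ^ 4 * (d : ℝ) ≤ 1 / (d : ℝ) ^ 3 := by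
      rcases Nat.eq_zero_or_pos d with hd0 | hd0
      · simp [hd0]
      · have hdpos : (0 : ℝ) < d := by exact_mod_cast hd0
        rw [le_div_iff₀ (by positivity)]
        have h1 : l / 40 * d ≤ 1 := by
          rw [lt_div_iff₀ hl] at hdl
          linarith
        calc (l / 40) ^ 4 * d * (d : ℝ) ^ 3 = (l / 40 * d) ^ 4 := by ring
          _ ≤ 1 := pow_le_one₀ (by positivity) h1
    have := Real.add_one_le_exp (-(l / 40) ^ 4 * (d : ℝ))
    linarith
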